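/- Let $p$ be a prime and let $G$ be a finite group with a split $BN$-pair of characteristic $p$. That is, $B,N\subseteq G$ are subgroups such that: - $G=\langle B,N\rangle$, and $H:=B\cap N$ is normal in $N$; - $W:=N/H$ is generated by a set $S$ of elements $s$ with $s^2=1$; - if $n_s\in N$ represents $s\in S$, then $n_sBn_s^{-1}\neq B$, and $n_sBn\subseteq Bn_snB\cup BnB$ for all $n\in N$; - $B=U\rtimes H$, where $U$ is a normal $p$-subgroup of $B$ and $H$ is abelian of order prime to $p$; - $\bigcap_{n\in N}nBn^{-1}=H$. Let $l\colon W\to\mathbb{N}_0$ be the length function with respect to $S$, let $n_w\in N$ be a representative of $w$ for each $w\in W$, and let $n_0\in N$ be a representative of the longest element $w_0\in W$. Put $V:=n_0^{-1}Un_0$ and $U_w:=U\cap n_w^{-1}Vn_w$. Let $k$ be a field with $|U|1_k\neq 0$, and let $\sigma\colon U\to k^\times$ be a group homomorphism which is non-degenerate, i.e. $\sigma|_{U_s}$ is non-trivial for every $s\in S$. Let $\sigma^*(u):=\sigma(u)^{-1}$, and define in $kG$ $$\underline{\mathfrak b}:=\sum_{b\in B}b,\qquad \underline{\mathfrak u}_\sigma:=\sum_{u\in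 U}\sigma(u)u,\qquad \mathfrak e:=\sum_{w\in W}(-1)^{l(w)}n_w\underline{\mathfrak b}.$$ Let $\langle\ ,\ \rangle$ be the bilinear form on $kG\underline{\mathfrak b}$ such that $\langle g\underline{\mathfrak b},g'\underline{\mathfrak b}\rangle$ is $1$ if $gB=g'B$ and $0$ otherwise, and let $^\perp$ denote orthogonal complements in $kG\underline{\mathfrak b}$. Define left $kG$-modules $$\mathcal S_\sigma:=kG\,\underline{\mathfrak u}_\sigma n_0\underline{\mathfrak b},\quad D_\sigma:=\mathcal S_\sigma/(\mathcal S_\sigma\cap\mathcal S_{\sigma^*}^\perp),\quad \Gamma_\sigma:=kG\,\underline{\mathfrak u}_\sigma,\quad \mathrm{St}_k:=kG\,\mathfrak e .$$ Then: 1. $\mathcal S_\sigma=kG\,\underline{\mathfrak u}_\sigma\mathfrak e$, and hence $\mathcal S_\sigma\subseteq \mathrm{St}_k$. 2. $D_\sigma$ is simple and is a composition factor of $\mathrm{St}_k$ with multiplicity exactly $1$. 3. $D_\sigma$ is Hiss's distinguished composition factor: up to isomorphism there is exactly one indecomposable direct summand $P_{\mathrm{St}}$ of $\Gamma_\sigma$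 with $\mathrm{Hom}_{kG}(P_{\mathrm{St}},\mathrm{St}_k)\neq 0$; it has a unique maximal submodule, and the quotient by it is isomorphic to $D_\sigma$. -/

import Mathlib

/-- A group `G` with two subgroups `B`, `N` such that `B ∩ N` is normal in `N`. -/
structure BNData (G : Type*) [Group G] where
  B : Subgroup G
  N : Subgroup G
  normal_inter : ((B ⊓ N).subgroupOf N).Normal

namespace BNData

variable {G : Type*} [Group G]

/-- The subgroup `H = B ∩ N`. -/
abbrev H (D : BNData G) : Subgroup G := D.B ⊓ D.N

instance (D : BNData G) : (D.H.subgroupOf D.N).Normal := D.normal_inter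

/-- The group `W = N / H`. -/
abbrev W (D : BNData G) : Type _ := D.N ⧸ D.H.subgroupOf D.N

/-- The class in `W` of an element of `N`. -/
abbrev cls (D : BNData G) (n : D.N) : D.W := QuotientGroup.mk n

end BNData

/-- The subgroup `g X g⁻¹`. -/
def conjSubgroup {G : Type*} [Group G] (g : G) (X : Subgroup G) : Subgroup G :=
  X.map (MulAut.conj g).toMonoidHom

/-- A `BN`-pair in `G`: subgroups `B`, `N` and a set `S` of elements of `W = N / (B ∩ N)`
satisfying the axioms of Tits. -/
structure BNPair (G : Type*) [Group G] extends BNData G where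
  S : Set toBNData.W
  generated : B ⊔ N = ⊤
  closure_S : Subgroup.closure S = ⊤
  sq_S : ∀ s ∈ S, s * s = 1
  conj_ne : ∀ m : N, toBNData.cls m ∈ S → conjSubgroup (m : G) B ≠ B
  mul_subset : ∀ m : N, toBNData.cls m ∈ S → ∀ n : N, ∀ b ∈ B,
    (m : G) * b * n ∈ DoubleCoset.doubleCoset ((m : G) * n) (B : Set G) (B : Set G) ∪
      DoubleCoset.doubleCoset (n : G) (B : Set G) (B : Set G)

/-- A split `BN`-pair of characteristic `p` in `G` (meant for finite `G`): a `BN`-pair such that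
`B = U ⋊ H` with `U` a normal `p`-subgroup of `B` and `H = B ∩ N` an abelian group of order prime
to `p`, and such that the intersection of all `n B n⁻¹`, `n ∈ N`, equals `H`. -/
structure SplitBNPair (p : ℕ) (G : Type*) [Group G] extends BNPair G where
  U : Subgroup G
  U_le : U ≤ B
  U_normal : (U.subgroupOf B).Normal
  U_inf_H : U ⊓ toBNData.H = ⊥
  U_sup_H : U ⊔ toBNData.H = B
  U_pGroup : IsPGroup p U
  H_comm : ∀ x ∈ toBNData.H, ∀ y ∈ toBNData.H, x * y = y * x
  H_coprime : (Nat.card toBNData.H).Coprime p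
  saturated : ∀ g : G, (∀ n ∈ N, g ∈ conjSubgroup n B) ↔ g ∈ toBNData.H

namespace BNPair

/-- The length of `w ∈ W` with respect to `S`: the least length of an expression of `w` as a
product of elements of `S`. -/
noncomputable def length {G : Type*} [Group G] (D : BNPair G) (w : D.W) : ℕ :=
  sInf {m : ℕ | ∃ l : List D.W, (∀ s ∈ l, s ∈ D.S) ∧ l.prod = w ∧ l.length = m}

/-- The class of `n₀` is an element of maximal length in `W`. -/
def RepresentsLongest {G : Type*} [Group G] (D : BNPair G) (n₀ : D.N) : Prop :=
  ∀ w : D.W, D.length w ≤ D.length (D.cls n₀)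

end BNPair

section Modules

/-- The left submodule `kG x` of `kG`. -/
noncomputable abbrev leftIdeal {k G : Type*} [Field k] [Group G] (x : MonoidAlgebra k G) :
    Submodule (MonoidAlgebra k G) (MonoidAlgebra k G) :=
  Submodule.span (MonoidAlgebra k G) {x}

/-- `m` is the multiplicity of `X` as a composition factor of `M`: the module `M` has a composition
series, and in each of its composition series exactly `m` of the factors are isomorphic to `X`. -/
def HasMultiplicity (R M X : Type*) [Ring R] [AddCommGroup M] [Module R M]
    [AddCommGroup X] [Module R X] (m : ℕ) : Prop :=
  (∃ s : CompositionSeries (Submodule R M), s.head = ⊥ ∧ s.last = ⊤) ∧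
  ∀ s : CompositionSeries (Submodule R M), s.head = ⊥ → s.last = ⊤ →
    Nat.card {i : Fin s.length //
      Nonempty ((↥(s i.succ) ⧸ (s i.castSucc).submoduleOf (s i.succ)) ≃ₗ[R] X)} = m

/-- `M` is indecomposable: it is non-zero and not the direct sum of two non-zero submodules. -/
def IsIndecomposableModule (R M : Type*) [Ring R] [AddCommGroup M] [Module R M] : Prop :=
  Nontrivial M ∧ ∀ X Y : Submodule R M, IsCompl X Y → X = ⊥ ∨ Y = ⊥

/-- `P` is an indecomposable direct summand of `M` with `Hom(P, X) ≠ 0`. -/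
def IsIndecomposableSummandOver {R M : Type*} (X : Type*) [Ring R] [AddCommGroup M] [Module R M]
    [AddCommGroup X] [Module R X] (P : Submodule R M) : Prop :=
  (∃ Q : Submodule R M, IsCompl P Q) ∧ IsIndecomposableModule R P ∧ ∃ f : P →ₗ[R] X, f ≠ 0

/-- `X` is the unique simple quotient of `P`: there is exactly one maximal submodule of `P`, and the
quotient by it is isomorphic to `X`. -/
def HasUniqueSimpleQuotient (R P X : Type*) [Ring R] [AddCommGroup P] [Module R P]
    [AddCommGroup X] [Module R X] : Prop :=
  (∃! M : Submodule R P, IsCoatom M) ∧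
    ∀ M : Submodule R P, IsCoatom M → Nonempty ((P ⧸ M) ≃ₗ[R] X)

end Modules

namespace SplitBNPair

variable {p : ℕ} {G : Type*} [Group G] (D : SplitBNPair p G)

/-- The subgroup `U_w = U ∩ n_w⁻¹ V n_w` with `V = n₀⁻¹ U n₀`, where `g = n_w`. -/
def Uw (n₀ g : G) : Subgroup G :=
  D.U ⊓ conjSubgroup g⁻¹ (conjSubgroup n₀⁻¹ D.U)

/-- The homomorphism `σ : U → kˣ` is non-degenerate: its restriction to `U_s` is non-trivial for
all `s ∈ S`. Here `n₀` represents the longest element and `n w` represents `w`. -/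
def NonDegenerate {k : Type*} [Field k] (n₀ : D.N) (n : D.W → D.N) (σ : D.U →* kˣ) : Prop :=
  ∀ s ∈ D.S, ∃ u : D.U, (u : G) ∈ D.Uw n₀ (n s) ∧ σ u ≠ 1

variable (k : Type*) [Field k]

/-- The sum of all elements of `B` in `kG`. -/
noncomputable def bSum : MonoidAlgebra k G :=
  ∑ᶠ b : D.B, MonoidAlgebra.of k G (b : G)

/-- The left `kG`-module generated by the sum of the elements of `B`. -/
noncomputable abbrev permModule : Submodule (MonoidAlgebra k G) (MonoidAlgebra k G) :=
  leftIdeal (D.bSum k)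

/-- The element `∑ σ(u) u` of `kG`, with `u` running over `U`. -/
noncomputable def uSum {k : Type*} [Field k] (σ : D.U →* kˣ) : MonoidAlgebra k G :=
  ∑ᶠ u : D.U, (σ u : k) • MonoidAlgebra.of k G (u : G)

/-- The element `e = ∑ (-1) ^ l(w) n_w b` of `kG`, with `w` running over `W` and `b` the sum of
the elements of `B`. -/
noncomputable def steinbergElt (n : D.W → D.N) : MonoidAlgebra k G :=
  ∑ᶠ w : D.W, (-1 : k) ^ D.length w • (MonoidAlgebra.of k G (n w : G) * D.bSum k)

/-- The Steinberg module `kG e`. -/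
noncomputable abbrev steinberg (n : D.W → D.N) :
    Submodule (MonoidAlgebra k G) (MonoidAlgebra k G) :=
  leftIdeal (D.steinbergElt k n)

/-- Elements of the module generated by the sum of the elements of `B` are constant on left
cosets of `B`. -/
theorem coeff_mul_of_mem [Finite G] {a : MonoidAlgebra k G} (ha : a ∈ D.permModule k)
    (g : G) {c : G} (hc : c ∈ D.B) : a.coeff (g * c) = a.coeff g := by
  obtain ⟨x, rfl⟩ := Submodule.mem_span_singleton.1 ha
  have hb : D.bSum k * MonoidAlgebra.of k G c = D.bSum k := by
    cases nonempty_fintype D.B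
    unfold bSum
    rw [finsum_eq_sum_of_fintype, Finset.sum_mul]
    refine Fintype.sum_equiv (Equiv.mulRight (⟨c, hc⟩ : D.B)) _ _ fun b => ?_
    simp
  have h2 : (x • D.bSum k) * MonoidAlgebra.of k G c = x • D.bSum k := by
    rw [smul_eq_mul, mul_assoc, hb]
  conv_lhs => rw [← h2]
  simp [MonoidAlgebra.of_apply]

/-- The bilinear form on the module generated by the sum `b` of the elements of `B`. As its
elements are constant on left cosets, each is the sum of the terms `a(g) g b`, with `g` running
over representatives of the cosets, so this is the form for which the elements `g b` are an
orthonormal basis; see `permForm_single`. -/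
noncomputable def permForm [Finite G] : LinearMap.BilinForm k (D.permModule k) :=
  LinearMap.mk₂ k
    (fun a a' => ∑ᶠ x : G ⧸ D.B, a.1.coeff x.out * a'.1.coeff x.out)
    (by
      cases nonempty_fintype (G ⧸ D.B)
      intro a b c
      simp [finsum_eq_sum_of_fintype, add_mul, Finset.sum_add_distrib])
    (by
      cases nonempty_fintype (G ⧸ D.B)
      intro r a b
      simp [finsum_eq_sum_of_fintype, Finset.mul_sum, mul_assoc])
    (by
      cases nonempty_fintype (G ⧸ D.B)
      intro a b c
      simp [finsum_eq_sum_of_fintype, mul_add, Finset.sum_add_distrib])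
    (by
      cases nonempty_fintype (G ⧸ D.B)
      intro r a b
      simp [finsum_eq_sum_of_fintype, Finset.mul_sum, mul_left_comm])

/-- The form is invariant under `G`. -/
theorem permForm_of_smul [Finite G] (g : G) (a a' : D.permModule k) :
    D.permForm k (MonoidAlgebra.of k G g • a) a' =
      D.permForm k a (MonoidAlgebra.of k G g⁻¹ • a') := by
  cases nonempty_fintype (G ⧸ D.B)
  have key : ∀ (c : D.permModule k) (h : G) (x : G ⧸ D.B),
      c.1.coeff (h * x.out) = c.1.coeff (h • x).out := by
    intro c h x
    have : (QuotientGroup.mk (h * x.out) : G ⧸ D.B) = QuotientGroup.mk (h • x).out := by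
      conv_rhs => rw [QuotientGroup.out_eq', ← QuotientGroup.out_eq' x]
      rfl
    have h1 := QuotientGroup.eq.1 this
    have h2 := D.coeff_mul_of_mem k c.2 (h * x.out) h1
    rw [← h2]
    congr 1
    group
  simp only [permForm, LinearMap.mk₂_apply, finsum_eq_sum_of_fintype]
  refine Fintype.sum_equiv (MulAction.toPerm g⁻¹) _ _ fun x => ?_
  have e1 : (MonoidAlgebra.of k G g • a : D.permModule k).1.coeff x.out =
      a.1.coeff (g⁻¹ * x.out) := by
    simp [MonoidAlgebra.of_apply]
  have e2 : (MonoidAlgebra.of k G g⁻¹ • a' : D.permModule k).1.coeff (g⁻¹ • x).out =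
      a'.1.coeff x.out := by
    have : (MonoidAlgebra.of k G g⁻¹ • a' : D.permModule k).1.coeff (g⁻¹ • x).out =
      a'.1.coeff (g * (g⁻¹ • x).out) := by
      simp [MonoidAlgebra.of_apply]
    rw [this, key, smul_inv_smul]
  rw [e1, key, MulAction.toPerm_apply, e2]

theorem coeff_of_mul_bSum [Finite G] (g h : G) [Decidable (g⁻¹ * h ∈ D.B)] :
    (MonoidAlgebra.of k G g * D.bSum k).coeff h = if g⁻¹ * h ∈ D.B then 1 else 0 := by
  classical
  cases nonempty_fintype D.B
  have : ∀ y : G, (D.bSum k).coeff y = if y ∈ D.B then 1 else 0 := by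
    intro y
    unfold bSum
    rw [finsum_eq_sum_of_fintype, MonoidAlgebra.coeff_sum, Finsupp.finsetSum_apply]
    simp only [MonoidAlgebra.of_apply, MonoidAlgebra.coeff_single, Finsupp.single_apply]
    split_ifs with hy
    · rw [Finset.sum_eq_single (⟨y, hy⟩ : D.B)]
      · simp
      · intro b _ hb
        rw [if_neg]
        rintro rfl
        exact hb rfl
      · simp
    · refine Finset.sum_eq_zero fun b _ => ?_
      rw [if_neg]
      rintro rfl
      exact hy b.2
  rw [MonoidAlgebra.of_apply, MonoidAlgebra.coeff_single_mul_apply, one_mul, this]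
  congr

/-- The defining property of the form: `⟨g b, g' b⟩` is `1` if `g B = g' B`, and `0` otherwise. -/
theorem permForm_single [Finite G] (g g' : G)
    (hg : MonoidAlgebra.of k G g * D.bSum k ∈ D.permModule k)
    (hg' : MonoidAlgebra.of k G g' * D.bSum k ∈ D.permModule k)
    [Decidable ((g : G ⧸ D.B) = (g' : G ⧸ D.B))] :
    D.permForm k ⟨_, hg⟩ ⟨_, hg'⟩ = if (g : G ⧸ D.B) = (g' : G ⧸ D.B) then 1 else 0 := by
  classical
  cases nonempty_fintype (G ⧸ D.B)
  simp only [permForm, LinearMap.mk₂_apply, finsum_eq_sum_of_fintype, coeff_of_mul_bSum,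
    ← QuotientGroup.eq, QuotientGroup.out_eq']
  simp [eq_comm]

/-- The orthogonal `X^⊥ = {a | ⟨a, x⟩ = 0 for all x ∈ X}`, for a submodule `X` of the module
generated by the sum of the elements of `B`. -/
noncomputable def perp [Finite G] (X : Submodule (MonoidAlgebra k G) (MonoidAlgebra k G)) :
    Submodule (MonoidAlgebra k G) (MonoidAlgebra k G) where
  carrier := {a | ∃ ha : a ∈ D.permModule k, ∀ x : D.permModule k, x.1 ∈ X →
    D.permForm k ⟨a, ha⟩ x = 0}
  zero_mem' := ⟨Submodule.zero_mem _, fun x _ =>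
    LinearMap.map_zero₂ (D.permForm k) x⟩
  add_mem' := by
    rintro a b ⟨ha, ha'⟩ ⟨hb, hb'⟩
    refine ⟨Submodule.add_mem _ ha hb, fun x hx => ?_⟩
    have := LinearMap.map_add₂ (D.permForm k) ⟨a, ha⟩ ⟨b, hb⟩ x
    rw [ha' x hx, hb' x hx, add_zero] at this
    exact this
  smul_mem' := by
    rintro c a ⟨ha, ha'⟩
    refine ⟨Submodule.smul_mem _ c ha, ?_⟩
    change ∀ x : D.permModule k, x.1 ∈ X → D.permForm k (c • ⟨a, ha⟩) x = 0
    intro x hx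
    induction c using MonoidAlgebra.induction_on with
    | of g =>
      rw [permForm_of_smul]
      exact ha' _ (Submodule.smul_mem X _ hx)
    | add c d hc hd => rw [add_smul, LinearMap.map_add₂, hc, hd, add_zero]
    | smul r c hc => rw [smul_assoc, LinearMap.map_smul₂, hc, smul_zero]

variable {k}

/-- The module `S_σ = kG u_σ n₀ b`. -/
noncomputable abbrev sMod (n₀ : D.N) (σ : D.U →* kˣ) :
    Submodule (MonoidAlgebra k G) (MonoidAlgebra k G) :=
  leftIdeal (D.uSum σ * MonoidAlgebra.of k G (n₀ : G) * D.bSum k)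

/-- The module `D_σ = S_σ / (S_σ ∩ S_{σ*}^⊥)`, where `σ*(u) = σ(u)⁻¹`. -/
abbrev dMod [Finite G] (n₀ : D.N) (σ : D.U →* kˣ) : Type _ :=
  ↥(D.sMod n₀ σ) ⧸
    (D.sMod n₀ σ ⊓ D.perp k (D.sMod n₀ σ⁻¹)).submoduleOf (D.sMod n₀ σ)

/-- The module `Γ_σ = kG u_σ`. -/
noncomputable abbrev gammaMod (σ : D.U →* kˣ) :
    Submodule (MonoidAlgebra k G) (MonoidAlgebra k G) :=
  leftIdeal (D.uSum σ)

end SplitBNPair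

/-! Left multiplication by `u_σ` (that is, `uSum σ`) maps the whole permutation module `kG b` onto
the line through `v = u_σ n₀ b`. Every coset of `B` has the form `u m B` with `u ∈ U`, `m ∈ N`, and
`u_σ u = σ(u)⁻¹ u_σ`, so only the elements `m b` matter. If the class `w` of `m` is not `w₀`, some
`s ∈ S` has `l(sw) > l(w)`; then `U_s` fixes `m B`, and non-triviality of `σ` on `U_s` forces `u_σ m
b = 0` (`uSum_mul_eq_zero`). For `w = w₀`, `U` acts freely on the orbit of `n₀ B`, so `v ≠ 0`. Hence
`u_σ e = ± v`, which is the first claim. The geometric input, derived from the axioms through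
lengths and Bruhat cells, is that an element of `B` fixing the far end of a minimal gallery from `B`
fixes each chamber on it (`conj_mem_of_length_add`).

As `u_σ² = |U| u_σ` with `|U|` invertible, the rest is formal (`IsEigenline`): a submodule of `kG b`
contains `v` or is killed by `u_σ`. So `S_σ = kG v` has a unique maximal submodule, the largest one
killed by `u_σ`; since `u_σ` and `u_{σ*}` are adjoint for the form, it is `S_σ ∩ S_{σ*}^⊥`. In a
composition series of `St_k`, the factor `D_σ` occurs exactly where `v` enters. Finally `Γ_σ` is
projective, and a non-zero map from a summand of it to `St_k` has image `S_σ`; an indecomposable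
such summand is therefore a projective cover of `D_σ`. -/

namespace BNPair

variable {G : Type*} [Group G] (D : BNPair G)

/-! ### The length function -/

theorem exists_word (w : D.W) : ∃ l : List D.W, (∀ s ∈ l, s ∈ D.S) ∧ l.prod = w := by
  have hw : w ∈ Subgroup.closure D.S := by rw [D.closure_S]; trivial
  rw [← Subgroup.mem_toSubmonoid, Subgroup.closure_toSubmonoid] at hw
  obtain ⟨l, hl, rfl⟩ := Submonoid.exists_list_of_mem_closure hw
  refine ⟨l, fun s hs => ?_, rfl⟩
  rcases hl s hs with h | h
  · exact h
  · rw [Set.mem_inv] at h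
    rwa [← inv_inv s, ← eq_inv_of_mul_eq_one_left (D.sq_S _ h)]

theorem exists_reduced_word (w : D.W) :
    ∃ l : List D.W, (∀ s ∈ l, s ∈ D.S) ∧ l.prod = w ∧ l.length = D.length w := by
  obtain ⟨l, h, h'⟩ := D.exists_word w
  exact Nat.sInf_mem
    (s := {m : ℕ | ∃ l : List D.W, (∀ s ∈ l, s ∈ D.S) ∧ l.prod = w ∧ l.length = m})
    ⟨_, l, h, h', rfl⟩

theorem length_prod_le (l : List D.W) (h : ∀ s ∈ l, s ∈ D.S) : D.length l.prod ≤ l.length :=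
  Nat.sInf_le ⟨l, h, rfl, rfl⟩

@[simp] theorem length_one : D.length 1 = 0 := by
  simpa using D.length_prod_le [] (by simp)

theorem length_mul_le (v w : D.W) : D.length (v * w) ≤ D.length v + D.length w := by
  obtain ⟨l, h, rfl, h'⟩ := D.exists_reduced_word v
  obtain ⟨m, g, rfl, g'⟩ := D.exists_reduced_word w
  rw [← h', ← g', ← List.prod_append, ← List.length_append]
  refine D.length_prod_le _ fun s hs => ?_
  rcases List.mem_append.1 hs with hs | hs
  exacts [h s hs, g s hs]

variable {D}

theorem inv_of_mem {s : D.W} (hs : s ∈ D.S) : s⁻¹ = s :=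
  (eq_inv_of_mul_eq_one_left (D.sq_S s hs)).symm

theorem mul_cancel_of_mem {s : D.W} (hs : s ∈ D.S) (w : D.W) : s * (s * w) = w := by
  rw [← mul_assoc, D.sq_S s hs, one_mul]

theorem length_le_one {s : D.W} (hs : s ∈ D.S) : D.length s ≤ 1 := by
  simpa using D.length_prod_le [s] (by simpa)

theorem length_mul_le_left {s : D.W} (hs : s ∈ D.S) (w : D.W) :
    D.length (s * w) ≤ D.length w + 1 := by
  have := D.length_mul_le s w
  have := length_le_one hs
  omega

theorem length_le_mul_left {s : D.W} (hs : s ∈ D.S) (w : D.W) :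
    D.length w ≤ D.length (s * w) + 1 := by
  simpa [mul_cancel_of_mem hs] using length_mul_le_left hs (s * w)

theorem length_inv_le (w : D.W) : D.length w⁻¹ ≤ D.length w := by
  obtain ⟨l, h, rfl, h'⟩ := D.exists_reduced_word w
  rw [← h', List.prod_inv_reverse]
  refine (D.length_prod_le _ ?_).trans (by simp)
  intro s hs
  simp only [List.mem_reverse, List.mem_map] at hs
  obtain ⟨a, ha, rfl⟩ := hs
  rw [inv_of_mem (h a ha)]
  exact h a ha

@[simp] theorem length_inv (w : D.W) : D.length w⁻¹ = D.length w :=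
  (length_inv_le w).antisymm (by simpa using length_inv_le w⁻¹)

theorem eq_one_of_length_eq_zero {w : D.W} (hw : D.length w = 0) : w = 1 := by
  obtain ⟨l, h, rfl, h'⟩ := D.exists_reduced_word w
  rw [hw, List.length_eq_zero_iff] at h'
  simp [h']

theorem exists_eq_mul_left {w : D.W} {m : ℕ} (hw : D.length w = m + 1) :
    ∃ s ∈ D.S, ∃ v, w = s * v ∧ D.length v = m := by
  obtain ⟨l, h, rfl, h'⟩ := D.exists_reduced_word w
  cases l with
  | nil => simp at hw
  | cons s l =>
    have hs : s ∈ D.S := h s (by simp)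
    refine ⟨s, hs, l.prod, by simp, ?_⟩
    have h1 := D.length_prod_le l fun t ht => h t (by simp [ht])
    have h2 := length_mul_le_left hs l.prod
    rw [List.prod_cons] at hw h'
    rw [List.length_cons] at h'
    omega

theorem exists_eq_mul_right {w : D.W} {m : ℕ} (hw : D.length w = m + 1) :
    ∃ s ∈ D.S, ∃ v, w = v * s ∧ D.length v = m := by
  obtain ⟨s, hs, v, h, h'⟩ := exists_eq_mul_left (w := w⁻¹) (m := m) (by simpa)
  refine ⟨s, hs, v⁻¹, ?_, by simpa⟩
  rw [← inv_inv w, h, mul_inv_rev, inv_of_mem hs]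

/-! ### Bruhat cells -/

variable (D) in
/-- The double coset `B w B`. -/
def cell (w : D.W) : Set G :=
  {x | ∃ m : D.N, D.cls m = w ∧ ∃ b ∈ D.B, ∃ c ∈ D.B, x = b * m * c}

theorem cls_surjective (w : D.W) : ∃ m : D.N, D.cls m = w :=
  QuotientGroup.mk_surjective w

theorem cls_mul (m m' : D.N) : D.cls (m * m') = D.cls m * D.cls m' := rfl

theorem cls_inv (m : D.N) : D.cls m⁻¹ = (D.cls m)⁻¹ := rfl

theorem cls_eq_iff {m m' : D.N} : D.cls m = D.cls m' ↔ (m : G)⁻¹ * m' ∈ D.B := by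
  rw [BNData.cls, BNData.cls, QuotientGroup.eq, Subgroup.mem_subgroupOf]
  exact ⟨fun h => h.1, fun h => ⟨h, (m⁻¹ * m').2⟩⟩

theorem cls_eq_one_iff {m : D.N} : D.cls m = 1 ↔ (m : G) ∈ D.B := by
  have : (1 : D.W) = D.cls 1 := rfl
  rw [this, eq_comm, cls_eq_iff]
  simp

theorem coe_mem_cell (m : D.N) : (m : G) ∈ D.cell (D.cls m) :=
  ⟨m, rfl, 1, one_mem _, 1, one_mem _, by simp⟩

theorem mul_mem_cell {w : D.W} {b x c : G} (hb : b ∈ D.B) (hx : x ∈ D.cell w) (hc : c ∈ D.B) :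
    b * x * c ∈ D.cell w := by
  obtain ⟨m, hm, b', hb', c', hc', rfl⟩ := hx
  exact ⟨m, hm, b * b', mul_mem hb hb', c' * c, mul_mem hc' hc, by group⟩

theorem left_mul_mem_cell {w : D.W} {b x : G} (hb : b ∈ D.B) (hx : x ∈ D.cell w) :
    b * x ∈ D.cell w := by
  simpa using mul_mem_cell hb hx (one_mem D.B)

theorem right_mul_mem_cell {w : D.W} {x c : G} (hx : x ∈ D.cell w) (hc : c ∈ D.B) :
    x * c ∈ D.cell w := by
  simpa using mul_mem_cell (one_mem D.B) hx hc

theorem inv_mem_cell {w : D.W} {x : G} (hx : x ∈ D.cell w) : x⁻¹ ∈ D.cell w⁻¹ := by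
  obtain ⟨m, rfl, b, hb, c, hc, rfl⟩ := hx
  exact ⟨m⁻¹, rfl, c⁻¹, inv_mem hc, b⁻¹, inv_mem hb, by simp [mul_assoc]⟩

theorem exists_eq_of_mem_cell {m : D.N} {x : G} (hx : x ∈ D.cell (D.cls m)) :
    ∃ b ∈ D.B, ∃ c ∈ D.B, x = b * m * c := by
  obtain ⟨m', h, b, hb, c, hc, rfl⟩ := hx
  exact ⟨b, hb, (m : G)⁻¹ * m' * c, mul_mem (cls_eq_iff.1 h.symm) hc, by group⟩

theorem mem_cell_one {x : G} : x ∈ D.cell 1 ↔ x ∈ D.B := by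
  constructor
  · rintro ⟨m, hm, b, hb, c, hc, rfl⟩
    exact mul_mem (mul_mem hb (cls_eq_one_iff.1 hm)) hc
  · intro hx
    exact ⟨1, rfl, x, hx, 1, one_mem _, by simp⟩

theorem cell_mul_subset {s w : D.W} (hs : s ∈ D.S) {x y : G} (hx : x ∈ D.cell s)
    (hy : y ∈ D.cell w) : x * y ∈ D.cell (s * w) ∨ x * y ∈ D.cell w := by
  obtain ⟨m, rfl, b, hb, c, hc, rfl⟩ := hx
  obtain ⟨m', rfl, b', hb', c', hc', rfl⟩ := hy
  have key := D.mul_subset m hs m' (c * b') (mul_mem hc hb')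
  have e : b * m * c * (b' * m' * c') = b * (m * (c * b') * m') * c' := by group
  rw [e]
  refine key.imp (fun h => ?_) fun h => ?_
  · obtain ⟨d, hd, d', hd', h⟩ := DoubleCoset.mem_doubleCoset.1 h
    rw [h]
    exact mul_mem_cell hb ⟨m * m', rfl, d, hd, d', hd', rfl⟩ hc'
  · obtain ⟨d, hd, d', hd', h⟩ := DoubleCoset.mem_doubleCoset.1 h
    rw [h]
    exact mul_mem_cell hb ⟨m', rfl, d, hd, d', hd', rfl⟩ hc'

theorem cell_mul_subset_right {s w : D.W} (hs : s ∈ D.S) {x y : G} (hx : x ∈ D.cell w)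
    (hy : y ∈ D.cell s) : x * y ∈ D.cell (w * s) ∨ x * y ∈ D.cell w := by
  have := cell_mul_subset (w := w⁻¹) (x := y⁻¹) (y := x⁻¹) hs
    (by simpa [inv_of_mem hs] using inv_mem_cell hy) (inv_mem_cell hx)
  refine this.imp (fun h => ?_) fun h => ?_
  · simpa [inv_of_mem hs] using inv_mem_cell h
  · simpa using inv_mem_cell h

theorem ne_one_of_mem {s : D.W} (hs : s ∈ D.S) : s ≠ 1 := by
  rintro rfl
  refine D.conj_ne 1 hs ?_
  ext x
  simp [conjSubgroup]

variable (D) in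
/-- The Bruhat decomposition. -/
theorem exists_mem_cell (x : G) : ∃ w, x ∈ D.cell w := by
  have hN : ∀ w : D.W, ∀ m : D.N, D.cls m = w → ∀ y, (∃ v, y ∈ D.cell v) →
      ∃ v, (m : G) * y ∈ D.cell v := by
    intro w
    have hw : w ∈ Subgroup.closure D.S := by rw [D.closure_S]; trivial
    have h1 : ∀ m : D.N, D.cls m = 1 → ∀ y, (∃ v, y ∈ D.cell v) → ∃ v, (m : G) * y ∈ D.cell v :=
      fun m hm y ⟨v, hv⟩ => ⟨v, left_mul_mem_cell (cls_eq_one_iff.1 hm) hv⟩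
    have hS : ∀ s ∈ D.S, ∀ m : D.N, D.cls m = s → ∀ y, (∃ v, y ∈ D.cell v) →
        ∃ v, (m : G) * y ∈ D.cell v := by
      rintro s hs m rfl y ⟨v, hv⟩
      rcases cell_mul_subset hs (coe_mem_cell m) hv with h | h
      exacts [⟨_, h⟩, ⟨_, h⟩]
    have hmul : ∀ a b : D.W, (∀ m : D.N, D.cls m = a → ∀ y, (∃ v, y ∈ D.cell v) →
        ∃ v, (m : G) * y ∈ D.cell v) → (∀ m : D.N, D.cls m = b → ∀ y, (∃ v, y ∈ D.cell v) →
        ∃ v, (m : G) * y ∈ D.cell v) → (∀ m : D.N, D.cls m = a * b → ∀ y, (∃ v, y ∈ D.cell v) →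
        ∃ v, (m : G) * y ∈ D.cell v) := by
      intro a b ha hb m hm y hy
      obtain ⟨m', rfl⟩ := cls_surjective a
      have := ha m' rfl _ (hb (m'⁻¹ * m) (by rw [cls_mul, hm, cls_inv, inv_mul_cancel_left]) y hy)
      simpa [mul_assoc] using this
    obtain ⟨l, hl, rfl⟩ := D.exists_word w
    clear hw
    induction l with
    | nil => simpa using h1
    | cons s l ih =>
      rw [List.prod_cons]
      exact hmul _ _ (hS s (hl s (by simp))) (ih fun t ht => hl t (by simp [ht]))
  have hmul : ∀ a ∈ (D.B : Set G) ∪ D.N, ∀ y, (∃ v, y ∈ D.cell v) → ∃ v, a * y ∈ D.cell v := by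
    rintro a (ha | ha) y hy
    · obtain ⟨v, hv⟩ := hy
      exact ⟨v, left_mul_mem_cell ha hv⟩
    · exact hN _ ⟨a, ha⟩ rfl y hy
  have hx : x ∈ Subgroup.closure ((D.B : Set G) ∪ D.N) := by
    rw [Subgroup.closure_union, Subgroup.closure_eq, Subgroup.closure_eq, D.generated]
    trivial
  induction hx using Subgroup.closure_induction_left with
  | one => exact ⟨1, mem_cell_one.2 (one_mem _)⟩
  | mul_left a ha y _ ih => exact hmul a ha y ih
  | inv_mul_cancel a ha y _ ih =>
    exact hmul a⁻¹ (ha.imp (fun h => D.B.inv_mem h) fun h => D.N.inv_mem h) y ih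

/-- Induction on `l(v)`, stripping a first letter `s` from `v = s v'`: a representative of `v'` lies
in the cell of `s w` or of `w`. The second would give `w = v'`, shorter than `v`. -/
theorem eq_of_mem_cell_of_length_le {v w : D.W} {x : G} (hv : x ∈ D.cell v) (hw : x ∈ D.cell w)
    (h : D.length v ≤ D.length w) : v = w := by
  obtain ⟨m, hm⟩ : ∃ m, m = D.length v := ⟨_, rfl⟩
  induction m generalizing v w x with
  | zero =>
    obtain rfl := eq_one_of_length_eq_zero hm.symm
    obtain ⟨m, rfl⟩ := cls_surjective w
    obtain ⟨b, hb, c, hc, rfl⟩ := exists_eq_of_mem_cell hw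
    rw [mem_cell_one, Subgroup.mul_mem_cancel_right _ hc, Subgroup.mul_mem_cancel_left _ hb] at hv
    exact (cls_eq_one_iff.2 hv).symm
  | succ m ih =>
    obtain ⟨s, hs, v, rfl, hv'⟩ := exists_eq_mul_left hm.symm
    obtain ⟨r, rfl⟩ := cls_surjective s
    obtain ⟨m', rfl⟩ := cls_surjective v
    obtain ⟨b, hb, c, hc, rfl⟩ := exists_eq_of_mem_cell (m := r * m') hv
    have h1 : (r : G) * m' ∈ D.cell w := by
      have := mul_mem_cell (inv_mem hb) hw (inv_mem hc)
      simpa [mul_assoc] using this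
    have h2 : (m' : G) ∈ D.cell (D.cls r * w) ∨ (m' : G) ∈ D.cell w := by
      have h3 := inv_mem_cell (coe_mem_cell r)
      rw [inv_of_mem hs] at h3
      simpa using cell_mul_subset hs h3 h1
    have h4 := length_le_mul_left hs w
    rcases h2 with h2 | h2
    · rw [ih (coe_mem_cell m') h2 (by omega) hv'.symm, mul_cancel_of_mem hs]
    · have := ih (coe_mem_cell m') h2 (by omega) hv'.symm
      rw [this] at hv'
      omega

/-- Distinct Bruhat cells are disjoint. -/
theorem eq_of_mem_cell {v w : D.W} {x : G} (hv : x ∈ D.cell v) (hw : x ∈ D.cell w) : v = w := by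
  rcases le_total (D.length v) (D.length w) with h | h
  exacts [eq_of_mem_cell_of_length_le hv hw h, (eq_of_mem_cell_of_length_le hw hv h).symm]

/-- Induction on `w = v t`. A product lying in the cell of `w` would, by the case of `v`, also lie
in the cell of `s v t` or of `s v`. By disjointness `w = s w`, or `w = s v` and `s w = v` is too
short. -/
theorem mul_mem_cell_of_length_le {s w : D.W} (hs : s ∈ D.S) (h : D.length w ≤ D.length (s * w))
    {x y : G} (hx : x ∈ D.cell s) (hy : y ∈ D.cell w) : x * y ∈ D.cell (s * w) := by
  obtain ⟨m, hm⟩ : ∃ m, m = D.length w := ⟨_, rfl⟩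
  induction m generalizing w y with
  | zero =>
    obtain rfl := eq_one_of_length_eq_zero hm.symm
    rw [mul_one]
    exact right_mul_mem_cell hx (mem_cell_one.1 hy)
  | succ m ih =>
    refine (cell_mul_subset hs hx hy).resolve_right fun h0 => ?_
    obtain ⟨t, ht, v, rfl, hv⟩ := exists_eq_mul_right hm.symm
    obtain ⟨r, rfl⟩ := cls_surjective t
    obtain ⟨m', rfl⟩ := cls_surjective v
    obtain ⟨b, hb, c, hc, rfl⟩ := exists_eq_of_mem_cell (m := m' * r) hy
    have h1 : D.length (s * (D.cls m' * D.cls r)) ≤ D.length (s * D.cls m') + 1 := by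
      have := D.length_mul_le (s * D.cls m') (D.cls r)
      have := length_le_one ht
      rw [← mul_assoc]
      omega
    have h2 := ih (y := b * m') (by omega) (left_mul_mem_cell hb (coe_mem_cell m')) hv.symm
    have h3 := cell_mul_subset_right ht h2 (right_mul_mem_cell (coe_mem_cell r) hc)
    have e : x * (b * m') * (r * c) = x * (b * ((m' * r : D.N) : G) * c) := by
      rw [Subgroup.coe_mul]; group
    rw [e] at h3
    rcases h3 with h3 | h3
    · have := eq_of_mem_cell h0 h3
      rw [mul_assoc, right_eq_mul] at this
      exact ne_one_of_mem hs this
    · have h4 := eq_of_mem_cell h0 h3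
      rw [h4, mul_cancel_of_mem hs] at h
      rw [h4] at hm
      omega

/-- Otherwise `BsB · BsB ⊆ B`, and a representative of `s` would normalise `B`, against `conj_ne`.
-/
theorem exists_mul_mul_mem_cell {s : D.W} (hs : s ∈ D.S) :
    ∃ x ∈ D.cell s, ∃ y ∈ D.cell s, x * y ∈ D.cell s := by
  obtain ⟨r, rfl⟩ := cls_surjective s
  by_contra! hcon
  have hr : (r : G)⁻¹ ∈ D.cell (D.cls r) := by
    simpa [inv_of_mem hs] using inv_mem_cell (coe_mem_cell r)
  have key : ∀ x ∈ D.cell (D.cls r), ∀ y ∈ D.cell (D.cls r), x * y ∈ D.B := by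
    intro x hx y hy
    rcases cell_mul_subset hs hx hy with h | h
    · rwa [D.sq_S _ hs, mem_cell_one] at h
    · exact absurd h (hcon x hx y hy)
  refine D.conj_ne r hs (le_antisymm ?_ ?_)
  · rintro _ ⟨b, hb, rfl⟩
    exact key _ (right_mul_mem_cell (coe_mem_cell r) hb) _ hr
  · intro b hb
    refine ⟨(r : G)⁻¹ * b * r, ?_, by simp [mul_assoc]⟩
    exact key _ (right_mul_mem_cell hr hb) _ (coe_mem_cell r)

/-- With equal lengths, cells multiply exactly in both directions. For `x`, `y`, `x y` all in `BsB`,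
the element `x y m` would lie in the cells of both `w` and `s w`. -/
theorem length_mul_ne {s : D.W} (hs : s ∈ D.S) (w : D.W) : D.length (s * w) ≠ D.length w := by
  intro h
  obtain ⟨x, hx, y, hy, hxy⟩ := exists_mul_mul_mem_cell hs
  obtain ⟨m, rfl⟩ := cls_surjective w
  have h1 := mul_mem_cell_of_length_le hs h.ge hy (coe_mem_cell m)
  have h2 := mul_mem_cell_of_length_le hs (by rw [mul_cancel_of_mem hs, h]) hx h1
  have h3 := mul_mem_cell_of_length_le hs h.ge hxy (coe_mem_cell m)
  rw [mul_assoc] at h3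
  have := eq_of_mem_cell h2 h3
  rw [mul_cancel_of_mem hs, right_eq_mul] at this
  exact ne_one_of_mem hs this

/-- If `su` and `ut` are longer than `u` but `sut` is shorter than `ut`, then `su = ut`. -/
theorem mul_eq_mul_of_length_lt {s t u : D.W} (hs : s ∈ D.S) (ht : t ∈ D.S)
    (hsu : D.length u < D.length (s * u)) (hut : D.length u < D.length (u * t))
    (hsut : D.length (s * u * t) < D.length (u * t)) : s * u = u * t := by
  obtain ⟨x, hx, y, hy, hxy⟩ := exists_mul_mul_mem_cell hs
  obtain ⟨m, rfl⟩ := cls_surjective u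
  obtain ⟨r, rfl⟩ := cls_surjective t
  have h0 : ∀ z ∈ D.cell s, z * m * r ∈ D.cell (s * D.cls m * D.cls r) ∨
      z * m * r ∈ D.cell (s * D.cls m) := fun z hz =>
    cell_mul_subset_right ht (mul_mem_cell_of_length_le hs hsu.le hz (coe_mem_cell m))
      (coe_mem_cell r)
  have h1 : ∀ z ∈ D.cell s, z * m * r ∈ D.cell (D.cls m * D.cls r) →
      s * D.cls m = D.cls m * D.cls r := by
    intro z hz h
    rcases h0 z hz with h' | h'
    · have := eq_of_mem_cell h h'
      rw [← this] at hsut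
      exact absurd hsut (lt_irrefl _)
    · exact eq_of_mem_cell h' h
  have hmr : ((m * r : D.N) : G) ∈ D.cell (D.cls m * D.cls r) := coe_mem_cell (m * r)
  rw [Subgroup.coe_mul] at hmr
  -- If `y m r` falls in the cell of `s u t`, multiplying by `x` returns it to that of `u t`,
  -- because `s u t` is shorter. Either way `h1` applies, to `x y` or to `y`.
  rcases cell_mul_subset hs hy hmr with h | h
  · have h2 := mul_mem_cell_of_length_le hs
      (by rw [mul_cancel_of_mem hs, ← mul_assoc]; exact hsut.le) hx h
    rw [mul_cancel_of_mem hs] at h2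
    exact h1 _ hxy (by simpa [mul_assoc] using h2)
  · exact h1 y hy (by simpa [mul_assoc] using h)

theorem length_mul_eq_or {s : D.W} (hs : s ∈ D.S) (w : D.W) :
    D.length (s * w) = D.length w + 1 ∨ D.length w = D.length (s * w) + 1 := by
  have := length_mul_ne hs w
  have := length_mul_le_left hs w
  have := length_le_mul_left hs w
  omega

/-- The exchange condition. -/
theorem exists_exchange {s w v : D.W} (hs : s ∈ D.S)
    (hwv : D.length (w * v) = D.length w + D.length v) (hsw : D.length w < D.length (s * w))
    (h : D.length (s * (w * v)) < D.length (w * v)) :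
    ∃ v', s * (w * v) = w * v' ∧ D.length v' < D.length v := by
  obtain ⟨m, hm⟩ : ∃ m, m = D.length v := ⟨_, rfl⟩
  induction m generalizing w v with
  | zero =>
    obtain rfl := eq_one_of_length_eq_zero hm.symm
    rw [mul_one] at h
    omega
  | succ m ih =>
    obtain ⟨t, ht, v, rfl, hv⟩ := exists_eq_mul_left hm.symm
    have h1 := D.length_mul_le (w * t) v
    have h2 := D.length_mul_le w t
    have h3 := length_le_one ht
    rw [mul_assoc] at h1
    -- Either `s` still lengthens `w t`, and `t` is absorbed into `w`, or `s w = w t` and the letter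
    -- `t` cancels.
    rcases length_mul_eq_or hs (w * t) with h4 | h4
    · obtain ⟨v', e, hv'⟩ := ih (w := w * t) (v := v) (by rw [mul_assoc]; omega) (by omega)
        (by rwa [mul_assoc]) hv.symm
      refine ⟨t * v', by rw [← mul_assoc w t v, e, mul_assoc], ?_⟩
      have := length_mul_le_left ht v'
      omega
    · have e := mul_eq_mul_of_length_lt hs ht hsw (by omega) (by rw [mul_assoc]; omega)
      refine ⟨v, ?_, by omega⟩
      rw [← mul_assoc, e, mul_assoc, mul_cancel_of_mem ht]

/-! ### The longest element -/

/-- Every `x` begins a reduced expression of `w`. For `x = s y` with `s` lengthening `y`, the letter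
lost in passing from `w` to `s w` must come from the part after `y`. -/
theorem length_add_length_of_forall_lt {w : D.W} (hw : ∀ s ∈ D.S, D.length (s * w) < D.length w)
    (x : D.W) : D.length x + D.length (x⁻¹ * w) = D.length w := by
  obtain ⟨m, hm⟩ : ∃ m, m = D.length x := ⟨_, rfl⟩
  induction m generalizing x with
  | zero =>
    obtain rfl := eq_one_of_length_eq_zero hm.symm
    simp
  | succ m ih =>
    obtain ⟨s, hs, y, rfl, hy⟩ := exists_eq_mul_left hm.symm
    have h1 := ih y hy.symm
    obtain ⟨v, e, hv⟩ := exists_exchange (w := y) (v := y⁻¹ * w) hs (by rw [h1, mul_inv_cancel_left])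
      (by omega) (by rw [mul_inv_cancel_left]; exact hw s hs)
    rw [mul_inv_cancel_left] at e
    have h2 := D.length_mul_le (s * y) ((s * y)⁻¹ * w)
    rw [mul_inv_cancel_left] at h2
    rw [mul_inv_rev, inv_of_mem hs, mul_assoc, e, inv_mul_cancel_left] at h2 ⊢
    omega

/-- Used contrapositively: each `w ≠ w₀` is lengthened by some `s ∈ S`. -/
theorem eq_of_forall_lt {w w₀ : D.W} (h₀ : ∀ x, D.length x ≤ D.length w₀)
    (hw : ∀ s ∈ D.S, D.length (s * w) < D.length w) : w = w₀ := by
  have h1 := length_add_length_of_forall_lt hw w₀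
  have h2 := h₀ w
  exact (inv_mul_eq_one.1 (eq_one_of_length_eq_zero (by omega))).symm

theorem length_mul_lt_of_forall_le {w₀ : D.W} (h₀ : ∀ x, D.length x ≤ D.length w₀) (s : D.W)
    (hs : s ∈ D.S) : D.length (s * w₀) < D.length w₀ :=
  (h₀ _).lt_of_ne (length_mul_ne hs w₀)

theorem inv_eq_of_forall_le {w₀ : D.W} (h₀ : ∀ x, D.length x ≤ D.length w₀) : w₀⁻¹ = w₀ :=
  eq_of_forall_lt h₀ (length_mul_lt_of_forall_le (by simpa using h₀))

/-! ### Elements of `B` which fix a chamber `w B` -/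

/-- The element `m⁻¹ x m` lies in `B ∪ BtB`. If it were in `BtB`, then `(x m)⁻¹` would lie in `B t
m⁻¹ B` as well as in `B m⁻¹ B`. -/
theorem conj_mem_of_length_lt {t : D.W} (ht : t ∈ D.S) {m r : D.N} (hr : D.cls r = t)
    (h : D.length (D.cls m) < D.length (D.cls (m * r))) {x : G} (hx : x ∈ D.B)
    (hx' : (m * r : G)⁻¹ * x * (m * r) ∈ D.B) : (m : G)⁻¹ * x * m ∈ D.B := by
  subst hr
  have hr := inv_mem_cell (coe_mem_cell r)
  rw [inv_of_mem ht] at hr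
  have h1 := cell_mul_subset ht (right_mul_mem_cell (coe_mem_cell r) hx') hr
  have e : (r : G) * ((m * r : G)⁻¹ * x * (m * r)) * (r : G)⁻¹ = (m : G)⁻¹ * x * m := by group
  rw [e, D.sq_S _ ht, mem_cell_one] at h1
  refine h1.resolve_right fun h2 => ?_
  have h3 := mul_mem_cell_of_length_le (w := (D.cls m)⁻¹) ht
    (by rw [← inv_of_mem ht, ← mul_inv_rev, length_inv, length_inv]; exact h.le)
    (by rw [← inv_of_mem ht]; exact inv_mem_cell h2) (inv_mem_cell (coe_mem_cell m))
  have h4 : (x * m)⁻¹ ∈ D.cell (D.cls m)⁻¹ := inv_mem_cell (left_mul_mem_cell hx (coe_mem_cell m))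
  have e : ((m : G)⁻¹ * x * m)⁻¹ * (m : G)⁻¹ = (x * m)⁻¹ := by group
  rw [e] at h3
  exact ne_one_of_mem ht (right_eq_mul.1 (eq_of_mem_cell h4 h3))

/-- The length condition puts `m B` on a minimal gallery from `B` to `z B`; its chambers are shown
to be fixed one by one, starting from `z B`. -/
theorem conj_mem_of_length_add {m z : D.N}
    (h : D.length (D.cls z) = D.length (D.cls m) + D.length ((D.cls m)⁻¹ * D.cls z)) {x : G}
    (hx : x ∈ D.B) (hx' : (z : G)⁻¹ * x * z ∈ D.B) : (m : G)⁻¹ * x * m ∈ D.B := by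
  obtain ⟨l, hl⟩ : ∃ l, l = D.length ((D.cls m)⁻¹ * D.cls z) := ⟨_, rfl⟩
  induction l generalizing z with
  | zero =>
    have h1 := cls_eq_iff.1 (inv_mul_eq_one.1 (eq_one_of_length_eq_zero hl.symm))
    have := mul_mem (mul_mem h1 hx') (inv_mem h1)
    convert this using 1
    group
  | succ l ih =>
    obtain ⟨t, ht, v, e, hv⟩ := exists_eq_mul_right hl.symm
    obtain ⟨r, rfl⟩ := cls_surjective t
    have hv' : v = (D.cls m)⁻¹ * D.cls (z * r⁻¹) := by
      rw [cls_mul, cls_inv, ← mul_assoc, e, mul_inv_cancel_right]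
    have h1 := D.length_mul_le (D.cls m) v
    have h2 := D.length_mul_le (D.cls m * v) (D.cls r)
    have h3 := length_le_one ht
    rw [mul_assoc, ← e, mul_inv_cancel_left] at h2
    have e' : D.cls m * v = D.cls (z * r⁻¹) := by rw [hv', mul_inv_cancel_left]
    rw [e'] at h1 h2
    refine ih (z := z * r⁻¹) (by rw [← hv']; omega) ?_ (by rw [← hv', hv])
    refine conj_mem_of_length_lt ht (m := z * r⁻¹) (r := r) rfl ?_ hx ?_
    · rw [inv_mul_cancel_right]
      omega
    · simpa using hx'

theorem conj_mem_of_longest {n₀ : D.N} (h₀ : D.RepresentsLongest n₀) {x : G} (hx : x ∈ D.B)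
    (hx' : (n₀ : G)⁻¹ * x * n₀ ∈ D.B) (m : D.N) : (m : G)⁻¹ * x * m ∈ D.B :=
  conj_mem_of_length_add
    (length_add_length_of_forall_lt (length_mul_lt_of_forall_le h₀) (D.cls m)).symm hx hx'

/-- The hypotheses hold for `x ∈ U_s`, which fixes `B` and the chamber of `s w₀`. Since `l(w₀) =
l(sw) + l((sw)⁻¹ w₀)`, the chamber of `w` lies on a minimal gallery between these two. -/
theorem conj_mem_of_longest_of_lt {n₀ : D.N} (h₀ : D.RepresentsLongest n₀) {r m : D.N}
    (hr : D.cls r ∈ D.S) (h : D.length (D.cls m) < D.length (D.cls r * D.cls m)) {x : G}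
    (hx : x ∈ D.B) (hx' : (n₀ * r : G) * x * (n₀ * r : G)⁻¹ ∈ D.B) : (m : G)⁻¹ * x * m ∈ D.B := by
  have hz : D.cls (n₀ * r)⁻¹ = D.cls r * D.cls n₀ := by
    rw [cls_inv, cls_mul, mul_inv_rev, inv_of_mem hr, inv_eq_of_forall_le h₀]
  refine conj_mem_of_length_add (z := (n₀ * r)⁻¹) ?_ hx (by simpa [mul_assoc] using hx')
  have h1 := length_add_length_of_forall_lt (length_mul_lt_of_forall_le h₀) (D.cls r * D.cls m)
  have h2 := length_mul_lt_of_forall_le h₀ _ hr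
  have h3 := length_mul_eq_or hr (D.cls m)
  have h4 := length_mul_eq_or hr (D.cls n₀)
  rw [hz, ← mul_assoc]
  rw [mul_inv_rev, inv_of_mem hr] at h1
  omega

end BNPair

/-! ### Modules on which a ring element has a one-line image -/

section CyclicModules

/-- The largest submodule of `M` which is annihilated by `e`. -/
def annihilatedBy {R : Type*} [Ring R] (e : R) (M : Type*) [AddCommGroup M] [Module R M] :
    Submodule R M where
  carrier := {x | ∀ r : R, e • r • x = 0}
  zero_mem' := by simp
  add_mem' := by
    intro x y hx hy r
    rw [smul_add, smul_add, hx, hy, add_zero]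
  smul_mem' := by
    intro c x hx r
    rw [smul_smul r c]
    exact hx _

variable {R : Type*} [Ring R] {e : R} {M : Type*} [AddCommGroup M] [Module R M]

theorem smul_eq_zero_of_mem_annihilatedBy {x : M} (hx : x ∈ annihilatedBy e M) : e • x = 0 := by
  simpa using hx 1

theorem le_annihilatedBy {X : Submodule R M} (h : ∀ x ∈ X, e • x = 0) : X ≤ annihilatedBy e M :=
  fun _ hx _ => h _ (X.smul_mem _ hx)

/-- The element `v` of `M` is non-zero under multiplication by `e`, and each non-zero element
of `e M` generates the same submodule as `v`. -/
structure IsEigenline (e : R) (v : M) : Prop where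
  mem_span : ∀ m : M, e • m ≠ 0 → v ∈ Submodule.span R {e • m}
  smul_mem : ∀ m : M, e • m ∈ Submodule.span R {v}
  smul_ne : e • v ≠ 0

namespace IsEigenline

variable {v : M} (h : IsEigenline e v)
include h

/-- The basic dichotomy: a submodule contains `v` or is killed by `e`. -/
theorem smul_eq_zero_of_notMem {X : Submodule R M} (hv : v ∉ X) {x : M} (hx : x ∈ X) :
    e • x = 0 := by
  by_contra h0
  exact hv ((Submodule.span_singleton_le_iff_mem _ _).2 (X.smul_mem e hx) (h.mem_span x h0))

theorem le_annihilatedBy {X : Submodule R M} (hv : v ∉ X) : X ≤ annihilatedBy e M :=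
  _root_.le_annihilatedBy fun _ hx => h.smul_eq_zero_of_notMem hv hx

theorem of_injective {L : Type*} [AddCommGroup L] [Module R L] {j : L →ₗ[R] M}
    (hj : Function.Injective j) {l : L} (hl : j l = v) (hsp : Submodule.span R {l} = ⊤) :
    IsEigenline e l where
  mem_span m hm := by
    have := h.mem_span (j m) (by rwa [← map_smul, Ne, map_eq_zero_iff j hj])
    obtain ⟨r, hr⟩ := Submodule.mem_span_singleton.1 this
    rw [← map_smul, ← map_smul, ← hl] at hr
    exact Submodule.mem_span_singleton.2 ⟨r, hj hr⟩
  smul_mem m := by rw [hsp]; trivial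
  smul_ne h0 := h.smul_ne (by rw [← hl, ← map_smul, h0, map_zero])

/-- When `v` generates, a proper submodule misses `v`, so it is killed by `e`. -/
theorem isCoatom_annihilatedBy (hsp : Submodule.span R {v} = ⊤) :
    IsCoatom (annihilatedBy e M) := by
  refine ⟨fun h0 => h.smul_ne (smul_eq_zero_of_mem_annihilatedBy (h0 ▸ Submodule.mem_top)),
    fun X hX => ?_⟩
  by_contra h0
  refine hX.not_ge (h.le_annihilatedBy fun hv => h0 ?_)
  rw [eq_top_iff, ← hsp]
  exact (Submodule.span_singleton_le_iff_mem _ _).2 hv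

theorem eq_annihilatedBy (hsp : Submodule.span R {v} = ⊤) {X : Submodule R M}
    (hX : IsCoatom X) : X = annihilatedBy e M := by
  have hv : v ∉ X := fun hv => hX.1 <| by
    rw [eq_top_iff, ← hsp]
    exact (Submodule.span_singleton_le_iff_mem _ _).2 hv
  exact ((hX.le_iff.1 (h.le_annihilatedBy hv)).resolve_left
    (h.isCoatom_annihilatedBy hsp).1).symm

/-- The unique simple quotient of `R v`, here of a module `L` which embeds into `M` with image
`R v`, is a composition factor of `M` with multiplicity one. -/
theorem hasMultiplicity_one [IsNoetherian R M] [IsArtinian R M] {L : Type*} [AddCommGroup L]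
    [Module R L] {j : L →ₗ[R] M} (hj : Function.Injective j) {l : L} (hl : j l = v)
    (hsp : Submodule.span R {l} = ⊤) :
    HasMultiplicity R M (L ⧸ annihilatedBy e L) 1 := by
  have hL := h.of_injective hj hl hsp
  refine ⟨?_, fun s hs0 hs1 => ?_⟩
  · exact exists_compositionSeries_of_isNoetherian_isArtinian R M
  have hv0 : v ∉ s 0 := by
    change v ∉ s.head
    rw [hs0, Submodule.mem_bot]
    rintro rfl
    exact h.smul_ne (smul_zero e)
  have hv1 : v ∈ s (Fin.last _) := by
    change v ∈ s.last
    rw [hs1]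
    trivial
  have hmono : Monotone s := s.strictMono.monotone
  -- The factors isomorphic to the simple quotient are those not killed by `e`, and these are the
  -- steps at which `v` enters the series.
  have key : ∀ i : Fin s.length, Nonempty ((↥(s i.succ) ⧸
      (s i.castSucc).submoduleOf (s i.succ)) ≃ₗ[R] (L ⧸ annihilatedBy e L)) ↔
      v ∉ s i.castSucc ∧ v ∈ s i.succ := by
    intro i
    constructor
    · rintro ⟨f⟩
      have hne : ∃ x : s i.succ, e • (x : M) ∉ s i.castSucc := by
        obtain ⟨y, hy⟩ := f.surjective (Submodule.Quotient.mk l)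
        obtain ⟨x, rfl⟩ := Submodule.Quotient.mk_surjective _ y
        refine ⟨x, fun hx => ?_⟩
        have h1 : e • (Submodule.Quotient.mk x : ↥(s i.succ) ⧸
            (s i.castSucc).submoduleOf (s i.succ)) = 0 := by
          rw [← Submodule.Quotient.mk_smul, Submodule.Quotient.mk_eq_zero]
          exact hx
        have h2 := congrArg f h1
        rw [map_smul, hy, map_zero, ← Submodule.Quotient.mk_smul,
          Submodule.Quotient.mk_eq_zero] at h2
        refine (hL.isCoatom_annihilatedBy hsp).1 ((eq_top_iff).2 ?_)
        rw [← hsp, Submodule.span_singleton_le_iff_mem]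
        exact (Submodule.span_singleton_le_iff_mem _ _).2 h2 (hL.mem_span l hL.smul_ne)
      obtain ⟨x, hx⟩ := hne
      constructor
      · intro hv
        exact hx ((Submodule.span_singleton_le_iff_mem _ _).2 hv (h.smul_mem x))
      · by_contra hv
        refine hx ?_
        rw [h.smul_eq_zero_of_notMem hv x.2]
        exact zero_mem _
    · rintro ⟨h0, h1⟩
      -- Once `v` has entered, `j` maps `L` to the factor. This map is non-zero with simple target,
      -- so its kernel is the only maximal submodule of `L`.
      have hjr : ∀ x, j x ∈ s i.succ := by
        intro x
        obtain ⟨r, rfl⟩ := Submodule.mem_span_singleton.1 (hsp ▸ Submodule.mem_top : x ∈ _)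
        rw [map_smul, hl]
        exact Submodule.smul_mem _ _ h1
      have hsimple : IsSimpleModule R (↥(s i.succ) ⧸ (s i.castSucc).submoduleOf (s i.succ)) :=
        (covBy_iff_quot_is_simple (hmono (Fin.castSucc_le_succ i))).1 (s.step i)
      set φ : L →ₗ[R] (↥(s i.succ) ⧸ (s i.castSucc).submoduleOf (s i.succ)) :=
        (Submodule.mkQ _).comp (j.codRestrict _ hjr) with hφ
      have hφ0 : φ ≠ 0 := by
        intro h2
        have h3 := LinearMap.congr_fun h2 l
        rw [hφ, LinearMap.comp_apply, Submodule.mkQ_apply, LinearMap.zero_apply,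
          Submodule.Quotient.mk_eq_zero] at h3
        exact h0 (hl ▸ h3)
      have hsurj := LinearMap.surjective_of_ne_zero hφ0
      have hker : LinearMap.ker φ = annihilatedBy e L := by
        refine hL.eq_annihilatedBy hsp (isSimpleModule_iff_isCoatom.1 ?_)
        exact IsSimpleModule.congr (φ.quotKerEquivOfSurjective hsurj)
      exact ⟨(φ.quotKerEquivOfSurjective hsurj).symm.trans (Submodule.quotEquivOfEq _ _ hker)⟩
  have hex : ∃ i : Fin s.length, v ∉ s i.castSucc ∧ v ∈ s i.succ := by
    by_contra! hcon
    have : ∀ i, v ∉ s i := fun i => Fin.induction hv0 (fun i hi => hcon i hi) i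
    exact this _ hv1
  obtain ⟨i, hi⟩ := hex
  rw [Nat.card_eq_one_iff_unique]
  refine ⟨⟨fun a b => Subtype.ext ?_⟩, ⟨i, (key i).2 hi⟩⟩
  have ha := (key _).1 a.2
  have hb := (key _).1 b.2
  by_contra hab
  rcases lt_or_gt_of_ne hab with h1 | h1
  · exact hb.1 (hmono (Fin.succ_le_castSucc_iff.2 h1) ha.2)
  · exact ha.1 (hmono (Fin.succ_le_castSucc_iff.2 h1) hb.2)

end IsEigenline

/-! ### Indecomposable projective modules -/

/-- An endomorphism of an indecomposable module of finite length is nilpotent if it is not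
surjective. -/
theorem IsIndecomposableModule.isNilpotent_of_not_surjective [IsNoetherian R M] [IsArtinian R M]
    (hM : IsIndecomposableModule R M) {f : Module.End R M} (hf : ¬ Function.Surjective f) :
    IsNilpotent f := by
  obtain ⟨N, hN⟩ := Filter.eventually_atTop.1 f.eventually_isCompl_ker_pow_range_pow
  -- Fitting decomposition. The exponent `N + 1` is positive, so the range of the power lies in the
  -- range of `f`.
  have h1 := hN (N + 1) (by omega)
  rcases hM.2 _ _ h1 with h2 | h2
  · refine absurd ?_ hf
    have h3 : LinearMap.range (f ^ (N + 1)) = ⊤ := by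
      rw [← h1.sup_eq_top, h2, bot_sup_eq]
    rw [← LinearMap.range_eq_top, eq_top_iff, ← h3, pow_succ', Module.End.mul_eq_comp]
    exact LinearMap.range_comp_le_range _ _
  · exact ⟨N + 1, LinearMap.range_eq_bot.1 h2⟩

/-- An indecomposable projective module of finite length has a unique maximal submodule. -/
theorem IsIndecomposableModule.existsUnique_isCoatom [IsNoetherian R M] [IsArtinian R M]
    [Module.Projective R M] (hM : IsIndecomposableModule R M) :
    ∃! X : Submodule R M, IsCoatom X := by
  have := hM.1
  obtain ⟨X, hX⟩ := IsCoatomic.exists_coatom (Submodule R M)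
  refine ⟨X, hX, fun Y hY => ?_⟩
  by_contra hne
  have hsup : Y ⊔ X = ⊤ := hY.sup_eq_top_of_ne hX hne
  have hsurj : Function.Surjective (X.mkQ.comp Y.subtype) := by
    rw [← LinearMap.range_eq_top, LinearMap.range_comp, Submodule.range_subtype,
      Submodule.map_mkQ_eq_top, sup_comm, hsup]
  -- The lift gives an endomorphism with image in `Y`, hence nilpotent, which is the identity modulo
  -- `X`; so are its powers, which is absurd.
  obtain ⟨g, hg⟩ := Module.projective_lifting_property _ X.mkQ hsurj
  set f : Module.End R M := Y.subtype.comp g with hf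
  have hfX : ∀ x, f x - x ∈ X := by
    intro x
    have := LinearMap.congr_fun hg x
    rw [← Submodule.Quotient.eq]
    exact this
  have hns : ¬ Function.Surjective f := by
    intro h
    refine hY.1 (eq_top_iff.2 fun x _ => ?_)
    obtain ⟨y, rfl⟩ := h x
    exact (g y).2
  obtain ⟨N, hN⟩ := hM.isNilpotent_of_not_surjective hns
  have hpow : ∀ m x, (f ^ m) x - x ∈ X := by
    intro m x
    induction m with
    | zero => simp
    | succ m ih =>
      have := X.add_mem (hfX ((f ^ m) x)) ih
      rwa [sub_add_sub_cancel, ← Module.End.mul_apply, ← pow_succ'] at this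
  refine hX.1 (eq_top_iff.2 fun x _ => ?_)
  have := hpow N x
  rw [hN] at this
  simpa using this

/-- Projective modules of finite length with a unique maximal submodule are isomorphic if they
have a common simple quotient. -/
theorem nonempty_equiv_of_isCoatom_unique {P Q X : Type*} [AddCommGroup P] [Module R P]
    [AddCommGroup Q] [Module R Q] [AddCommGroup X] [Module R X] [IsSimpleModule R X]
    [IsNoetherian R Q] [Module.Projective R P] [Module.Projective R Q]
    (hP : IsIndecomposableModule R P)
    (hQu : ∃! Y : Submodule R Q, IsCoatom Y) (f : P →ₗ[R] X) (hf : Function.Surjective f)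
    (g : Q →ₗ[R] X) (hg : Function.Surjective g) : Nonempty (P ≃ₗ[R] Q) := by
  have hgk : IsCoatom (LinearMap.ker g) :=
    isSimpleModule_iff_isCoatom.1 (IsSimpleModule.congr (g.quotKerEquivOfSurjective hg))
  obtain ⟨φ, hφ⟩ := Module.projective_lifting_property g f hg
  -- A proper image would lie in the unique maximal submodule `ker g`, making `f = g φ` zero.
  have hsurj : Function.Surjective φ := by
    rw [← LinearMap.range_eq_top]
    by_contra h
    obtain ⟨Y, hY, hle⟩ := (eq_top_or_exists_le_coatom (LinearMap.range φ)).resolve_left h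
    rw [hQu.unique hY hgk] at hle
    have hf0 : f = 0 := by
      rw [← hφ]
      ext x
      exact hle ⟨x, rfl⟩
    have := IsSimpleModule.nontrivial R X
    obtain ⟨y, hy⟩ := exists_ne (0 : X)
    obtain ⟨x, rfl⟩ := hf y
    exact hy (by rw [hf0, LinearMap.zero_apply])
  obtain ⟨ψ, hψ⟩ := Module.projective_lifting_property φ LinearMap.id hsurj
  have hcompl : IsCompl (LinearMap.ker φ) (LinearMap.range ψ) := by
    have hψ' : ∀ y, φ (ψ y) = y := LinearMap.congr_fun hψ
    constructor
    · rw [Submodule.disjoint_def]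
      rintro _ hx ⟨y, rfl⟩
      rw [LinearMap.mem_ker, hψ'] at hx
      rw [hx, map_zero]
    · rw [codisjoint_iff, eq_top_iff]
      intro x _
      refine Submodule.mem_sup.2 ⟨x - ψ (φ x), ?_, ψ (φ x), ⟨_, rfl⟩, sub_add_cancel _ _⟩
      rw [LinearMap.mem_ker, map_sub, hψ', sub_self]
  rcases hP.2 _ _ hcompl with h | h
  · exact ⟨LinearEquiv.ofBijective φ ⟨LinearMap.ker_eq_bot.1 h, hsurj⟩⟩
  · exfalso
    have h0 : ∀ y : Q, y = 0 := by
      intro y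
      have := LinearMap.congr_fun hψ y
      rw [LinearMap.range_eq_bot.1 h] at this
      simpa using this.symm
    refine hgk.1 (eq_top_iff.2 fun y _ => ?_)
    rw [h0 y]
    exact zero_mem _

theorem hasUniqueSimpleQuotient_of_surjective {P X : Type*} [AddCommGroup P] [Module R P]
    [AddCommGroup X] [Module R X] [IsSimpleModule R X]
    (hP : ∃! Y : Submodule R P, IsCoatom Y) (f : P →ₗ[R] X) (hf : Function.Surjective f) :
    HasUniqueSimpleQuotient R P X := by
  refine ⟨hP, fun Y hY => ?_⟩
  have hker : IsCoatom (LinearMap.ker f) :=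
    isSimpleModule_iff_isCoatom.1 (IsSimpleModule.congr (f.quotKerEquivOfSurjective hf))
  rw [hP.unique hY hker]
  exact ⟨f.quotKerEquivOfSurjective hf⟩

/-- An indecomposable direct summand on which a given homomorphism is non-zero. -/
theorem exists_isIndecomposableSummandOver {Γ : Type*} [AddCommGroup Γ] [Module R Γ]
    [IsArtinian R Γ] {f : Γ →ₗ[R] M} (hf : f ≠ 0) :
    ∃ P : Submodule R Γ, IsIndecomposableSummandOver M P := by
  -- A minimal direct summand on which `f` is non-zero is indecomposable: `f` is non-zero on a part
  -- of any decomposition.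
  obtain ⟨P, ⟨⟨Q, hQ⟩, hP⟩, hmin⟩ := WellFounded.has_min (wellFounded_lt (α := Submodule R Γ))
    {P | (∃ Q, IsCompl P Q) ∧ f.domRestrict P ≠ 0} ⟨⊤, ⟨⊥, isCompl_top_bot⟩, fun h => hf <| by
      ext x
      exact LinearMap.congr_fun h ⟨x, trivial⟩⟩
  refine ⟨P, ⟨Q, hQ⟩, ⟨?_, fun X Y hXY => ?_⟩, _, hP⟩
  · by_contra h
    rw [not_nontrivial_iff_subsingleton] at h
    exact hP (Subsingleton.elim _ _)
  have aux : ∀ X Y : Submodule R P, IsCompl X Y → (∃ x ∈ X, f x ≠ 0) → Y = ⊥ := by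
    rintro X Y hXY ⟨x, hx, hfx⟩
    have hX : ∃ Z, IsCompl (X.map P.subtype) Z := by
      refine ⟨Y.map P.subtype ⊔ Q, ?_⟩
      constructor
      · rw [Submodule.disjoint_def]
        rintro _ ⟨a, ha, rfl⟩ hb
        obtain ⟨_, ⟨b, hb, rfl⟩, q, hq, h⟩ := Submodule.mem_sup.1 hb
        have h1 : q = P.subtype (a - b) := by rw [map_sub, ← h, add_sub_cancel_left]
        have h2 : (a - b : P) = 0 := by
          have := Submodule.disjoint_def.1 hQ.disjoint _ (a - b).2 (by simpa [h1] using hq)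
          exact Subtype.ext this
        rw [sub_eq_zero] at h2
        subst h2
        rw [Submodule.disjoint_def.1 hXY.disjoint _ ha hb, map_zero]
      · rw [codisjoint_iff, ← sup_assoc, ← Submodule.map_sup, hXY.sup_eq_top, Submodule.map_top,
          Submodule.range_subtype, hQ.sup_eq_top]
    have hle : X.map P.subtype ≤ P := Submodule.map_subtype_le _ _
    have h1 := hmin (X.map P.subtype) ⟨hX, fun h0 => hfx
      (LinearMap.congr_fun h0 ⟨x, x, hx, rfl⟩)⟩
    have h2 : X.map P.subtype = P := by
      by_contra h
      exact h1 (lt_of_le_of_ne hle h)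
    have h3 : X = ⊤ := by
      rw [eq_top_iff]
      intro a _
      have : (a : Γ) ∈ X.map P.subtype := by rw [h2]; exact a.2
      obtain ⟨b, hb, hab⟩ := this
      rwa [← Subtype.ext hab]
    rw [← hXY.inf_eq_bot, h3, top_inf_eq]
  by_cases hX : ∃ x ∈ X, f x ≠ 0
  · exact Or.inr (aux X Y hXY hX)
  by_cases hY : ∃ y ∈ Y, f y ≠ 0
  · exact Or.inl (aux Y X hXY.symm hY)
  push Not at hX hY
  refine absurd ?_ hP
  ext z
  obtain ⟨x, hx, y, hy, rfl⟩ := Submodule.mem_sup.1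
    (hXY.sup_eq_top ▸ Submodule.mem_top : z ∈ X ⊔ Y)
  simp [hX x hx, hY y hy]

/-! ### Maps from summands of a cyclic module -/

namespace IsEigenline

variable {v : M}

/-- The image of a non-zero homomorphism from a direct summand of `R g`, where `e g` is a unit
multiple of `g`. -/
theorem exists_surjective_of_summand (h : IsEigenline e v) {Γ : Type*} [AddCommGroup Γ]
    [Module R Γ] {g : Γ} (hsp : Submodule.span R {g} = ⊤) {t t' : R} (ht : t' * t = 1)
    (hg : e • g = t • g) {L : Type*} [AddCommGroup L] [Module R L] {j : L →ₗ[R] M}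
    (hj : Function.Injective j) {l : L} (hl : j l = v) (hspl : Submodule.span R {l} = ⊤)
    {P : Submodule R Γ} (hP : IsIndecomposableSummandOver M P) :
    ∃ f : P →ₗ[R] L, Function.Surjective f := by
  obtain ⟨⟨Q, hQ⟩, -, f, hf⟩ := hP
  set F : Γ →ₗ[R] M := f.comp (P.projectionOnto Q hQ) with hF
  have hFf : ∀ x : P, F x = f x := by
    intro x
    rw [hF, LinearMap.comp_apply, Submodule.projectionOnto_apply_left]
  -- Thus `F g` is a multiple of `e F g`, which lies in `R v` and, being non-zero, generates `v`.
  have htg : t' • (e • F g) = F g := by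
    rw [← map_smul, hg, ← map_smul, smul_smul, ht, one_smul]
  have hFe : e • F g ≠ 0 := by
    intro h0
    rw [h0, smul_zero] at htg
    refine hf (LinearMap.ext fun x => ?_)
    obtain ⟨r, hr⟩ := Submodule.mem_span_singleton.1 (hsp ▸ Submodule.mem_top : (x : Γ) ∈ _)
    rw [← hFf, ← hr, map_smul, ← htg, smul_zero, LinearMap.zero_apply]
  have hrange : ∀ x : P, f x ∈ LinearMap.range j := by
    intro x
    obtain ⟨r, hr⟩ := Submodule.mem_span_singleton.1 (hsp ▸ Submodule.mem_top : (x : Γ) ∈ _)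
    rw [← hFf, ← hr, map_smul, ← htg]
    refine Submodule.smul_mem _ _ (Submodule.smul_mem _ _ ?_)
    exact (Submodule.span_singleton_le_iff_mem v _).2 (LinearMap.mem_range.2 ⟨l, hl⟩) (h.smul_mem _)
  let j' := LinearEquiv.ofInjective j hj
  refine ⟨j'.symm.toLinearMap.comp (f.codRestrict _ hrange), ?_⟩
  rw [← LinearMap.range_eq_top, eq_top_iff, ← hspl, Submodule.span_singleton_le_iff_mem]
  obtain ⟨r, hr⟩ := Submodule.mem_span_singleton.1 (h.mem_span _ hFe)
  refine ⟨P.projectionOnto Q hQ (r • e • g), ?_⟩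
  rw [LinearMap.comp_apply]
  refine (LinearEquiv.symm_apply_eq _).2 (Subtype.ext ?_)
  change F (r • e • g) = j l
  rw [map_smul, map_smul, hr, hl]

end IsEigenline

/-- The map `R → R u` with `1 ↦ t' u` retracts the inclusion. -/
theorem projective_span_of_mul_self {u t' : R} (hu : u * (t' * u) = u) :
    Module.Projective R (Submodule.span R {u}) := by
  refine Module.Projective.of_split (Submodule.span R {u}).subtype
    (LinearMap.toSpanSingleton R _ ⟨t' * u, Submodule.mem_span_singleton.2 ⟨t', rfl⟩⟩) ?_
  ext ⟨x, hx⟩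
  obtain ⟨r, rfl⟩ := Submodule.mem_span_singleton.1 hx
  simp [mul_assoc, hu]

end CyclicModules

/-! ### The element `u_σ` and its action on the permutation module -/

namespace SplitBNPair

variable {p : ℕ} {G : Type*} [Group G] {D : SplitBNPair p G} {k : Type*} [Field k]

theorem mem_conjSubgroup {X : Subgroup G} {g x : G} :
    x ∈ conjSubgroup g X ↔ g⁻¹ * x * g ∈ X := by
  constructor
  · rintro ⟨y, hy, rfl⟩
    simpa [mul_assoc] using hy
  · intro h
    exact ⟨_, h, by simp [mul_assoc]⟩

theorem exists_mul_eq_of_mem {b : G} (hb : b ∈ D.B) : ∃ u ∈ D.U, ∃ h ∈ D.H, u * h = b := by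
  have hb' : b ∈ Subgroup.closure ((D.U : Set G) ∪ D.H) := by
    rwa [Subgroup.closure_union, Subgroup.closure_eq, Subgroup.closure_eq, D.U_sup_H]
  have key : ∀ a ∈ (D.U : Set G) ∪ D.H, ∀ y, (∃ u ∈ D.U, ∃ h ∈ D.H, u * h = y) →
      ∃ u ∈ D.U, ∃ h ∈ D.H, u * h = a * y := by
    rintro a (ha | ha) _ ⟨u, hu, h, hh, rfl⟩
    · exact ⟨a * u, mul_mem ha hu, h, hh, mul_assoc _ _ _⟩
    · have h1 := D.U_normal.conj_mem ⟨u, D.U_le hu⟩ hu ⟨a, ha.1⟩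
      exact ⟨a * u * a⁻¹, h1, a * h, mul_mem ha hh, by group⟩
  induction hb' using Subgroup.closure_induction_left with
  | one => exact ⟨1, one_mem _, 1, one_mem _, one_mul 1⟩
  | mul_left a ha y hy ih =>
    have ha' : a ∈ D.B := ha.elim (fun h => D.U_le h) fun h => h.1
    exact key a ha y (ih ((Subgroup.mul_mem_cancel_left _ ha').1 hb))
  | inv_mul_cancel a ha y hy ih =>
    have ha' : a ∈ D.B := ha.elim (fun h => D.U_le h) fun h => h.1
    exact key a⁻¹ (ha.imp (fun h => D.U.inv_mem h) fun h => D.H.inv_mem h) y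
      (ih ((Subgroup.mul_mem_cancel_left _ (inv_mem ha')).1 hb))

theorem leftIdeal_smul {x : MonoidAlgebra k G} {c : k} (hc : c ≠ 0) :
    leftIdeal (c • x) = leftIdeal x := by
  have h : ∀ (d : k) (y : MonoidAlgebra k G), leftIdeal (d • y) ≤ leftIdeal y := by
    intro d y
    rw [Submodule.span_singleton_le_iff_mem]
    exact Submodule.mem_span_singleton.2 ⟨algebraMap k _ d, by rw [algebraMap_smul]⟩
  refine (h c x).antisymm ?_
  simpa [smul_smul, hc] using h c⁻¹ (c • x)

theorem mul_bSum_mem (x : MonoidAlgebra k G) : x * D.bSum k ∈ D.permModule k :=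
  Submodule.mem_span_singleton.2 ⟨x, rfl⟩

theorem NonDegenerate.inv {n : D.W → D.N} {n₀ : D.N} {σ : D.U →* kˣ}
    (hσ : D.NonDegenerate n₀ n σ) : D.NonDegenerate n₀ n σ⁻¹ := by
  intro s hs
  obtain ⟨u, hu, h⟩ := hσ s hs
  exact ⟨u, hu, by simpa using h⟩

theorem span_singleton_mk {R A : Type*} [Ring R] [AddCommGroup A] [Module R A] (x : A) :
    Submodule.span R {(⟨x, Submodule.mem_span_singleton_self x⟩ : Submodule.span R {x})} = ⊤ := by
  rw [eq_top_iff]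
  rintro ⟨y, hy⟩ -
  obtain ⟨r, rfl⟩ := Submodule.mem_span_singleton.1 hy
  exact Submodule.mem_span_singleton.2 ⟨r, rfl⟩

/-- Fixing `B` and the opposite chamber `n₀ B`, `u` fixes all `m B` with `m ∈ N`, so it lies in `U ∩
H = 1` by saturation. -/
theorem eq_one_of_conj_mem {n₀ : D.N} (hn₀ : D.RepresentsLongest n₀) {u : G} (hu : u ∈ D.U)
    (h : (n₀ : G)⁻¹ * u * n₀ ∈ D.B) : u = 1 := by
  rw [← Subgroup.mem_bot, ← D.U_inf_H]
  refine ⟨hu, (D.saturated u).1 fun m hm => ?_⟩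
  rw [mem_conjSubgroup]
  exact BNPair.conj_mem_of_longest hn₀ (D.U_le hu) h ⟨m, hm⟩

theorem sMod_le_permModule {n₀ : D.N} {σ : D.U →* kˣ} : D.sMod n₀ σ ≤ D.permModule k := by
  rw [Submodule.span_singleton_le_iff_mem]
  exact mul_bSum_mem _

variable [Finite G]

variable (D) in
theorem of_mul_bSum {b : G} (hb : b ∈ D.B) :
    MonoidAlgebra.of k G b * D.bSum k = D.bSum k := by
  cases nonempty_fintype D.B
  unfold bSum
  rw [finsum_eq_sum_of_fintype, Finset.mul_sum]
  exact Fintype.sum_equiv (Equiv.mulLeft (⟨b, hb⟩ : D.B)) _ _ fun c => by simp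

variable (D) in
theorem of_mul_bSum_eq {g g' : G} (h : g⁻¹ * g' ∈ D.B) :
    MonoidAlgebra.of k G g * D.bSum k = MonoidAlgebra.of k G g' * D.bSum k := by
  have e : g' = g * (g⁻¹ * g') := by group
  rw [e, map_mul, mul_assoc, D.of_mul_bSum h]

theorem uSum_mul_of (σ : D.U →* kˣ) (u : D.U) :
    D.uSum σ * MonoidAlgebra.of k G (u : G) = ((σ u)⁻¹ : kˣ) • D.uSum σ := by
  cases nonempty_fintype D.U
  unfold uSum
  rw [finsum_eq_sum_of_fintype, Finset.sum_mul, Finset.smul_sum]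
  refine Fintype.sum_equiv (Equiv.mulRight u) _ _ fun v => ?_
  have hσ : (σ u)⁻¹ * σ (v * u) = σ v := by rw [map_mul, mul_comm (σ v), inv_mul_cancel_left]
  rw [smul_mul_assoc, ← map_mul, Equiv.coe_mulRight, Units.smul_def, smul_smul, ← Units.val_mul,
    hσ, Subgroup.coe_mul]

theorem uSum_mul_uSum (σ : D.U →* kˣ) :
    D.uSum σ * D.uSum σ = (Nat.card D.U : k) • D.uSum σ := by
  cases nonempty_fintype D.U
  conv_lhs => arg 2; unfold uSum
  rw [finsum_eq_sum_of_fintype, Finset.mul_sum]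
  have : ∀ u : D.U, D.uSum σ * ((σ u : k) • MonoidAlgebra.of k G (u : G)) = D.uSum σ := by
    intro u
    rw [mul_smul_comm, uSum_mul_of, Units.smul_def, smul_smul, Units.mul_inv, one_smul]
  simp only [this, Finset.sum_const, Finset.card_univ, Nat.card_eq_fintype_card]
  rw [← Nat.cast_smul_eq_nsmul k]

/-- Here `u g b = g b`, while `u_σ u = σ(u)⁻¹ u_σ`; so `u_σ g b` equals `σ(u)⁻¹` times itself. -/
theorem uSum_mul_eq_zero_of_conj_mem {σ : D.U →* kˣ} {u : D.U} (hu : σ u ≠ 1) {g : G}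
    (h : g⁻¹ * u * g ∈ D.B) : D.uSum σ * MonoidAlgebra.of k G g * D.bSum k = 0 := by
  have h1 : MonoidAlgebra.of k G (u * g : G) * D.bSum k = MonoidAlgebra.of k G g * D.bSum k :=
    (D.of_mul_bSum_eq (by rwa [← mul_assoc])).symm
  have h2 : D.uSum σ * MonoidAlgebra.of k G g * D.bSum k =
      ((σ u)⁻¹ : kˣ) • (D.uSum σ * MonoidAlgebra.of k G g * D.bSum k) := by
    conv_lhs => rw [mul_assoc, ← h1, map_mul, mul_assoc, ← mul_assoc, uSum_mul_of]
    simp only [Units.smul_def, smul_mul_assoc, mul_assoc]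
  rw [Units.smul_def] at h2
  by_contra h0
  have h3 : ((1 : k) - ((σ u)⁻¹ : kˣ)) • (D.uSum σ * MonoidAlgebra.of k G g * D.bSum k) = 0 := by
    rw [sub_smul, one_smul, ← h2, sub_self]
  have h4 := (smul_eq_zero.1 h3).resolve_right h0
  rw [sub_eq_zero, ← Units.val_one, Units.val_inj, eq_comm, inv_eq_one] at h4
  exact hu h4

theorem of_mul_bSum_eq_of_cls_eq {m m' : D.N} (h : D.cls m = D.cls m') :
    MonoidAlgebra.of k G (m : G) * D.bSum k = MonoidAlgebra.of k G (m' : G) * D.bSum k :=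
  D.of_mul_bSum_eq (BNPair.cls_eq_iff.1 h)

theorem coeff_uSum_mul {n₀ : D.N} (hn₀ : D.RepresentsLongest n₀) (σ : D.U →* kˣ) :
    (D.uSum σ * MonoidAlgebra.of k G (n₀ : G) * D.bSum k).coeff (n₀ : G) = 1 := by
  classical
  cases nonempty_fintype D.U
  unfold uSum
  rw [finsum_eq_sum_of_fintype, Finset.sum_mul, Finset.sum_mul, MonoidAlgebra.coeff_sum,
    Finsupp.finsetSum_apply, Finset.sum_eq_single 1]
  · rw [smul_mul_assoc, ← map_mul, smul_mul_assoc, MonoidAlgebra.coeff_smul, Finsupp.smul_apply,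
      coeff_of_mul_bSum, if_pos (by simp)]
    simp
  · intro u _ hu
    rw [smul_mul_assoc, ← map_mul, smul_mul_assoc, MonoidAlgebra.coeff_smul, Finsupp.smul_apply,
      coeff_of_mul_bSum, if_neg, smul_zero]
    intro h
    refine hu (inv_eq_one.1 (Subtype.ext ?_))
    refine eq_one_of_conj_mem hn₀ (u⁻¹).2 ?_
    simpa [mul_assoc] using h
  · simp

theorem uSum_mul_ne_zero {n₀ : D.N} (hn₀ : D.RepresentsLongest n₀) (σ : D.U →* kˣ) :
    D.uSum σ * MonoidAlgebra.of k G (n₀ : G) * D.bSum k ≠ 0 := by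
  intro h
  have := coeff_uSum_mul hn₀ σ
  rw [h] at this
  simp at this

variable {n : D.W → D.N} {n₀ : D.N} {σ : D.U →* kˣ}

theorem uSum_mul_eq_zero (hn : ∀ w : D.W, D.cls (n w) = w) (hn₀ : D.RepresentsLongest n₀)
    (hσ : D.NonDegenerate n₀ n σ) {m : D.N} (hm : D.cls m ≠ D.cls n₀) :
    D.uSum σ * MonoidAlgebra.of k G (m : G) * D.bSum k = 0 := by
  have hex : ∃ s ∈ D.S, D.length (D.cls m) < D.length (s * D.cls m) := by
    by_contra! h
    exact hm (BNPair.eq_of_forall_lt hn₀ fun s hs =>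
      (h s hs).lt_of_ne (BNPair.length_mul_ne hs _))
  obtain ⟨s, hs, h⟩ := hex
  obtain ⟨u, ⟨hu, hu'⟩, hσu⟩ := hσ s hs
  refine uSum_mul_eq_zero_of_conj_mem hσu ?_
  refine BNPair.conj_mem_of_longest_of_lt hn₀ (r := n s) (by rwa [hn]) (by rwa [hn])
    (D.U_le hu) (D.U_le ?_)
  have hu' := mem_conjSubgroup.1 (mem_conjSubgroup.1 hu')
  simpa [mul_assoc] using hu'

theorem exists_uSum_mul_of_eq_smul (hn : ∀ w : D.W, D.cls (n w) = w)
    (hn₀ : D.RepresentsLongest n₀) (hσ : D.NonDegenerate n₀ n σ) (g : G) :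
    ∃ c : k, D.uSum σ * (MonoidAlgebra.of k G g * D.bSum k) =
      c • (D.uSum σ * MonoidAlgebra.of k G (n₀ : G) * D.bSum k) := by
  obtain ⟨w, m, -, b, hb, c, hc, rfl⟩ := D.exists_mem_cell g
  obtain ⟨u, hu, h, hh, rfl⟩ := exists_mul_eq_of_mem hb
  -- `H` is normal in `N`, so `h m B = m B`.
  have e : MonoidAlgebra.of k G (u * h * m * c) * D.bSum k =
      MonoidAlgebra.of k G u * (MonoidAlgebra.of k G (m : G) * D.bSum k) := by
    rw [← mul_assoc, ← map_mul]
    refine D.of_mul_bSum_eq ?_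
    have h0 : D.cls ⟨h, hh.2⟩ = 1 := BNPair.cls_eq_one_iff.2 hh.1
    have h1 : D.cls m = D.cls (⟨h, hh.2⟩ * m) := by rw [BNPair.cls_mul, h0, one_mul]
    have h2 := mul_mem (inv_mem hc) (inv_mem (BNPair.cls_eq_iff.1 h1))
    simpa [mul_assoc] using h2
  rw [e, ← mul_assoc, uSum_mul_of σ ⟨u, hu⟩, Units.smul_def, smul_mul_assoc]
  by_cases hm : D.cls m = D.cls n₀
  · rw [of_mul_bSum_eq_of_cls_eq hm, ← mul_assoc]
    exact ⟨_, rfl⟩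
  · rw [← mul_assoc, uSum_mul_eq_zero hn hn₀ hσ hm]
    exact ⟨0, by simp⟩

theorem exists_uSum_mul_eq_smul (hn : ∀ w : D.W, D.cls (n w) = w)
    (hn₀ : D.RepresentsLongest n₀) (hσ : D.NonDegenerate n₀ n σ) {a : MonoidAlgebra k G}
    (ha : a ∈ D.permModule k) : ∃ c : k, D.uSum σ * a =
      c • (D.uSum σ * MonoidAlgebra.of k G (n₀ : G) * D.bSum k) := by
  obtain ⟨x, rfl⟩ := Submodule.mem_span_singleton.1 ha
  rw [smul_eq_mul]
  clear ha
  induction x using MonoidAlgebra.induction_on with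
  | of g => exact exists_uSum_mul_of_eq_smul hn hn₀ hσ g
  | add x y hx hy =>
    obtain ⟨c, hc⟩ := hx
    obtain ⟨d, hd⟩ := hy
    exact ⟨c + d, by rw [add_mul, mul_add, hc, hd, add_smul]⟩
  | smul r x hx =>
    obtain ⟨c, hc⟩ := hx
    exact ⟨r * c, by rw [smul_mul_assoc, mul_smul_comm, hc, smul_smul]⟩

theorem uSum_mul_steinbergElt (hn : ∀ w : D.W, D.cls (n w) = w)
    (hn₀ : D.RepresentsLongest n₀) (hσ : D.NonDegenerate n₀ n σ) :
    D.uSum σ * D.steinbergElt k n = (-1 : k) ^ D.length (D.cls n₀) •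
      (D.uSum σ * MonoidAlgebra.of k G (n₀ : G) * D.bSum k) := by
  cases nonempty_fintype D.W
  unfold steinbergElt
  rw [finsum_eq_sum_of_fintype, Finset.mul_sum, Finset.sum_eq_single (D.cls n₀)]
  · rw [mul_smul_comm, of_mul_bSum_eq_of_cls_eq (hn (D.cls n₀)), mul_assoc]
  · intro w _ hw
    rw [mul_smul_comm, ← mul_assoc, uSum_mul_eq_zero hn hn₀ hσ (by rwa [hn]), smul_zero]
  · simp

theorem sMod_eq (hn : ∀ w : D.W, D.cls (n w) = w)
    (hn₀ : D.RepresentsLongest n₀) (hσ : D.NonDegenerate n₀ n σ) :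
    D.sMod n₀ σ = leftIdeal (D.uSum σ * D.steinbergElt k n) := by
  rw [uSum_mul_steinbergElt hn hn₀ hσ, leftIdeal_smul (pow_ne_zero _ (by simp))]

theorem sMod_le (hn : ∀ w : D.W, D.cls (n w) = w)
    (hn₀ : D.RepresentsLongest n₀) (hσ : D.NonDegenerate n₀ n σ) :
    D.sMod n₀ σ ≤ D.steinberg k n := by
  rw [sMod_eq hn hn₀ hσ, Submodule.span_singleton_le_iff_mem]
  exact Submodule.mem_span_singleton.2 ⟨_, rfl⟩

theorem steinberg_le (n : D.W → D.N) : D.steinberg k n ≤ D.permModule k := by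
  cases nonempty_fintype D.W
  rw [Submodule.span_singleton_le_iff_mem]
  unfold steinbergElt
  rw [finsum_eq_sum_of_fintype]
  refine Submodule.sum_mem _ fun w _ => ?_
  rw [← smul_mul_assoc]
  exact mul_bSum_mem _

/-! ### The bilinear form -/

theorem permForm_of_mul_bSum (a : D.permModule k) (g : G) :
    D.permForm k a ⟨MonoidAlgebra.of k G g * D.bSum k, mul_bSum_mem _⟩ = a.1.coeff g := by
  classical
  cases nonempty_fintype (G ⧸ D.B)
  simp only [permForm, LinearMap.mk₂_apply, finsum_eq_sum_of_fintype, coeff_of_mul_bSum,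
    ← QuotientGroup.eq, QuotientGroup.out_eq']
  rw [Finset.sum_eq_single (g : G ⧸ D.B)]
  · have h : g⁻¹ * (g : G ⧸ D.B).out ∈ D.B := by
      rw [← QuotientGroup.eq, QuotientGroup.out_eq']
    rw [if_pos rfl, mul_one, ← D.coeff_mul_of_mem k a.2 g h, mul_inv_cancel_left]
  · intro x _ hx
    rw [if_neg (Ne.symm hx), mul_zero]
  · simp

/-- Invariance moves `u` across as `u⁻¹`, and `σ(u) = σ*(u⁻¹)`. -/
theorem permForm_uSum_smul (a a' : D.permModule k) :
    D.permForm k (D.uSum σ • a) a' = D.permForm k a (D.uSum σ⁻¹ • a') := by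
  cases nonempty_fintype D.U
  unfold uSum
  rw [finsum_eq_sum_of_fintype, finsum_eq_sum_of_fintype, Finset.sum_smul, Finset.sum_smul,
    map_sum, map_sum, LinearMap.sum_apply]
  refine Fintype.sum_equiv (Equiv.inv D.U) _ _ fun u => ?_
  rw [smul_assoc, smul_assoc, LinearMap.map_smul₂, LinearMap.map_smul, permForm_of_smul]
  simp

/-- The coefficient of `u_σ a` at `g` is `⟨u_σ a, g b⟩ = ⟨a, u_{σ*} g b⟩`, and `u_{σ*} g b` lies in
`S_{σ*}`. -/
theorem uSum_mul_eq_zero_of_mem_perp (hn : ∀ w : D.W, D.cls (n w) = w)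
    (hn₀ : D.RepresentsLongest n₀) (hσ : D.NonDegenerate n₀ n σ) {a : MonoidAlgebra k G}
    (ha : a ∈ D.perp k (D.sMod n₀ σ⁻¹)) : D.uSum σ * a = 0 := by
  obtain ⟨ha, h⟩ := ha
  ext g
  have h1 := permForm_of_mul_bSum (D.uSum σ • (⟨a, ha⟩ : D.permModule k)) g
  rw [permForm_uSum_smul, h] at h1
  · exact h1.symm
  · obtain ⟨c, hc⟩ := exists_uSum_mul_of_eq_smul hn hn₀ hσ.inv g
    change D.uSum σ⁻¹ * _ ∈ _
    rw [hc]
    refine Submodule.mem_span_singleton.2 ⟨algebraMap k _ c, by rw [algebraMap_smul]⟩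

/-- By adjointness, `⟨a, g u_{σ*} n₀ b⟩ = ⟨u_σ g⁻¹ a, n₀ b⟩`, and `g⁻¹ a` is still in `X`. -/
theorem le_perp {X : Submodule (MonoidAlgebra k G) (MonoidAlgebra k G)}
    (hX : X ≤ D.permModule k) (h : ∀ a ∈ X, D.uSum σ * a = 0) :
    X ≤ D.perp k (D.sMod n₀ σ⁻¹) := by
  intro a ha
  refine ⟨hX ha, ?_⟩
  rintro ⟨x, hx⟩ hxS
  obtain ⟨r, rfl⟩ := Submodule.mem_span_singleton.1 hxS
  set z : D.permModule k := ⟨MonoidAlgebra.of k G (n₀ : G) * D.bSum k, mul_bSum_mem _⟩ with hz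
  have e : (⟨r • (D.uSum σ⁻¹ * MonoidAlgebra.of k G (n₀ : G) * D.bSum k), hx⟩ : D.permModule k) =
      r • D.uSum σ⁻¹ • z := by
    refine Subtype.ext ?_
    simp [hz, mul_assoc]
  rw [e]
  clear e hx hxS
  induction r using MonoidAlgebra.induction_on with
  | of g =>
    have h1 := permForm_of_smul D k g⁻¹ ⟨a, hX ha⟩ (D.uSum σ⁻¹ • z)
    rw [inv_inv] at h1
    rw [← h1, ← permForm_uSum_smul]
    have h2 : D.uSum σ • MonoidAlgebra.of k G g⁻¹ • (⟨a, hX ha⟩ : D.permModule k) = 0 :=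
      Subtype.ext (h _ (X.smul_mem _ ha))
    rw [h2, LinearMap.map_zero₂]
  | add x y hx hy => rw [add_smul, map_add, hx, hy, add_zero]
  | smul r x hx => rw [smul_assoc, LinearMap.map_smul, hx, smul_zero]

theorem inf_perp_submoduleOf (hn : ∀ w : D.W, D.cls (n w) = w)
    (hn₀ : D.RepresentsLongest n₀) (hσ : D.NonDegenerate n₀ n σ) :
    (D.sMod n₀ σ ⊓ D.perp k (D.sMod n₀ σ⁻¹)).submoduleOf (D.sMod n₀ σ) =
      annihilatedBy (D.uSum σ) (D.sMod n₀ σ) := by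
  refine le_antisymm (le_annihilatedBy fun x hx => Subtype.ext ?_) fun x hx => ?_
  · exact uSum_mul_eq_zero_of_mem_perp hn hn₀ hσ hx.2
  · refine ⟨x.2, le_perp (X := (annihilatedBy (D.uSum σ) (D.sMod n₀ σ)).map (Submodule.subtype _))
      ((Submodule.map_subtype_le _ _).trans sMod_le_permModule) ?_ ⟨x, hx, rfl⟩⟩
    rintro _ ⟨y, hy, rfl⟩
    exact congrArg Subtype.val (smul_eq_zero_of_mem_annihilatedBy hy)

/-! ### The Steinberg module -/

theorem isEigenline (hn : ∀ w : D.W, D.cls (n w) = w) (hn₀ : D.RepresentsLongest n₀)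
    (hU : (Nat.card D.U : k) ≠ 0) (hσ : D.NonDegenerate n₀ n σ)
    {X : Submodule (MonoidAlgebra k G) (MonoidAlgebra k G)} (hX : X ≤ D.permModule k)
    (hv : D.uSum σ * MonoidAlgebra.of k G (n₀ : G) * D.bSum k ∈ X) :
    IsEigenline (D.uSum σ) (⟨_, hv⟩ : X) where
  mem_span m hm := by
    obtain ⟨c, hc⟩ := exists_uSum_mul_eq_smul hn hn₀ hσ (hX m.2)
    have hc0 : c ≠ 0 := by
      rintro rfl
      exact hm (Subtype.ext (hc.trans (zero_smul _ _)))
    refine Submodule.mem_span_singleton.2 ⟨algebraMap k _ c⁻¹, Subtype.ext ?_⟩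
    rw [algebraMap_smul]
    change c⁻¹ • (D.uSum σ * (m : MonoidAlgebra k G)) = _
    rw [hc, smul_smul, inv_mul_cancel₀ hc0, one_smul]
  smul_mem m := by
    obtain ⟨c, hc⟩ := exists_uSum_mul_eq_smul hn hn₀ hσ (hX m.2)
    refine Submodule.mem_span_singleton.2 ⟨algebraMap k _ c, Subtype.ext ?_⟩
    rw [algebraMap_smul]
    exact hc.symm
  smul_ne h := by
    have h1 := congrArg Subtype.val h
    change D.uSum σ * (D.uSum σ * MonoidAlgebra.of k G (n₀ : G) * D.bSum k) = 0 at h1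
    rw [← mul_assoc, ← mul_assoc, uSum_mul_uSum, smul_mul_assoc, smul_mul_assoc] at h1
    exact uSum_mul_ne_zero hn₀ σ ((smul_eq_zero.1 h1).resolve_left hU)

end SplitBNPair

/-! ### The distinguished composition factor -/

theorem proposition2p2 {p : ℕ} (hp : p.Prime) {G : Type*} [Group G] [Finite G]
    (D : SplitBNPair p G) {k : Type*} [Field k]
    (n : D.W → D.N) (hn : ∀ w : D.W, D.cls (n w) = w)
    (n₀ : D.N) (hn₀ : D.RepresentsLongest n₀)
    (hU : (Nat.card D.U : k) ≠ 0)
    (σ : D.U →* kˣ) (hσ : D.NonDegenerate n₀ n σ) :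
    D.sMod n₀ σ = leftIdeal (D.uSum σ * D.steinbergElt k n) ∧
    D.sMod n₀ σ ≤ D.steinberg k n ∧
    IsSimpleModule (MonoidAlgebra k G) (D.dMod n₀ σ) ∧
    HasMultiplicity (MonoidAlgebra k G) (D.steinberg k n) (D.dMod n₀ σ) 1 ∧
    (∃ P : Submodule (MonoidAlgebra k G) (D.gammaMod σ),
      IsIndecomposableSummandOver (D.steinberg k n) P) ∧
    (∀ P Q : Submodule (MonoidAlgebra k G) (D.gammaMod σ),
      IsIndecomposableSummandOver (D.steinberg k n) P →
      IsIndecomposableSummandOver (D.steinberg k n) Q →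
      Nonempty (P ≃ₗ[MonoidAlgebra k G] Q)) ∧
    ∀ P : Submodule (MonoidAlgebra k G) (D.gammaMod σ),
      IsIndecomposableSummandOver (D.steinberg k n) P →
      HasUniqueSimpleQuotient (MonoidAlgebra k G) P (D.dMod n₀ σ) := by
  have hle := SplitBNPair.sMod_le (k := k) hn hn₀ hσ
  have : Module.Finite k (MonoidAlgebra k G) := inferInstance
  have : IsNoetherian (MonoidAlgebra k G) (MonoidAlgebra k G) := isNoetherian_of_tower k inferInstance
  have : IsArtinian (MonoidAlgebra k G) (MonoidAlgebra k G) := isArtinian_of_tower k inferInstance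
  have hvS := Submodule.mem_span_singleton_self (R := MonoidAlgebra k G)
    (D.uSum σ * MonoidAlgebra.of k G (n₀ : G) * D.bSum k)
  have hM := SplitBNPair.isEigenline hn hn₀ hU hσ (SplitBNPair.steinberg_le n) (hle hvS)
  have hL := SplitBNPair.isEigenline hn hn₀ hU hσ SplitBNPair.sMod_le_permModule hvS
  have hspS := SplitBNPair.span_singleton_mk (R := MonoidAlgebra k G)
    (D.uSum σ * MonoidAlgebra.of k G (n₀ : G) * D.bSum k)
  have hspΓ := SplitBNPair.span_singleton_mk (R := MonoidAlgebra k G) (D.uSum σ)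
  have hannih := SplitBNPair.inf_perp_submoduleOf (k := k) hn hn₀ hσ
  have hsimple : IsSimpleModule (MonoidAlgebra k G) (D.dMod n₀ σ) := by
    rw [isSimpleModule_iff_isCoatom, hannih]
    exact hL.isCoatom_annihilatedBy hspS
  have hj := Submodule.inclusion_injective hle
  have ht : algebraMap k (MonoidAlgebra k G) (Nat.card D.U : k)⁻¹ *
      algebraMap k (MonoidAlgebra k G) (Nat.card D.U : k) = 1 := by
    rw [← map_mul, inv_mul_cancel₀ hU, map_one]
  have hproj : Module.Projective (MonoidAlgebra k G) (D.gammaMod σ) := by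
    refine projective_span_of_mul_self
      (t' := algebraMap k (MonoidAlgebra k G) (Nat.card D.U : k)⁻¹) ?_
    rw [← Algebra.smul_def, mul_smul_comm, SplitBNPair.uSum_mul_uSum, smul_smul,
      inv_mul_cancel₀ hU, one_smul]
  have hsurj : ∀ P : Submodule (MonoidAlgebra k G) (D.gammaMod σ),
      IsIndecomposableSummandOver (D.steinberg k n) P →
      ∃ f : P →ₗ[MonoidAlgebra k G] D.dMod n₀ σ, Function.Surjective f := by
    intro P hP
    obtain ⟨f, hf⟩ := hM.exists_surjective_of_summand hspΓ ht
      (Subtype.ext (by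
        rw [algebraMap_smul]
        exact SplitBNPair.uSum_mul_uSum σ)) hj rfl hspS hP
    exact ⟨(Submodule.mkQ _).comp f, (Submodule.mkQ_surjective _).comp hf⟩
  have hprojP : ∀ P : Submodule (MonoidAlgebra k G) (D.gammaMod σ),
      IsIndecomposableSummandOver (D.steinberg k n) P → Module.Projective (MonoidAlgebra k G) P := by
    rintro P ⟨⟨Q, hQ⟩, -⟩
    refine Module.Projective.of_split P.subtype (P.projectionOnto Q hQ) ?_
    ext x
    simp
  have huniq : ∀ P : Submodule (MonoidAlgebra k G) (D.gammaMod σ),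
      IsIndecomposableSummandOver (D.steinberg k n) P →
      ∃! X : Submodule (MonoidAlgebra k G) P, IsCoatom X := fun P hP =>
    have := hprojP P hP
    hP.2.1.existsUnique_isCoatom
  refine ⟨SplitBNPair.sMod_eq hn hn₀ hσ, hle, hsimple, ?_, ?_, fun P Q hP hQ => ?_, fun P hP => ?_⟩
  · have := hM.hasMultiplicity_one hj rfl hspS
    rwa [← hannih] at this
  -- Right multiplication by `e` sends `u_σ` to `u_σ e = ± v ≠ 0`.
  · refine exists_isIndecomposableSummandOver (f := ((LinearMap.toSpanSingleton (MonoidAlgebra k G)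
      (D.steinberg k n) ⟨_, Submodule.mem_span_singleton_self _⟩).domRestrict (D.gammaMod σ))) ?_
    intro h
    have h1 := congrArg Subtype.val
      (LinearMap.congr_fun h ⟨_, Submodule.mem_span_singleton_self _⟩)
    change D.uSum σ * D.steinbergElt k n = 0 at h1
    rw [SplitBNPair.uSum_mul_steinbergElt hn hn₀ hσ] at h1
    exact SplitBNPair.uSum_mul_ne_zero hn₀ σ
      ((smul_eq_zero.1 h1).resolve_left (pow_ne_zero _ (by simp)))
  · have := hprojP P hP
    have := hprojP Q hQ
    obtain ⟨f, hf⟩ := hsurj P hP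
    obtain ⟨g, hg⟩ := hsurj Q hQ
    exact nonempty_equiv_of_isCoatom_unique (P := P) (Q := Q) (X := D.dMod n₀ σ) hP.2.1
      (huniq Q hQ) f hf g hg
  · obtain ⟨f, hf⟩ := hsurj P hP
    exact hasUniqueSimpleQuotient_of_surjective (P := P) (X := D.dMod n₀ σ) (huniq P hP) f hf
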